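/- All lattices are bounded and distributive, all rings are commutative with $1$. A \emph{support} of a lattice $L$ on a ring $R$ is a map $d:R\to L$ with $d(0)=0$, $d(1)=1$, $d(xy)=d(x)\wedge d(y)$ and $d(x+y)\le d(x)\vee d(y)$. A \emph{sheaf of rings} on a lattice $L$ is a functor $\mathcal F:L^{op}\to\mathsf{CommRing}$ such that for every finite (possibly empty) join $x=u_1\vee\dots\vee u_n$ the diagram $\mathcal F(x)\to\prod_i\mathcal F(u_i)\rightrightarrows\prod_{i,j}\mathcal F(u_i\wedge u_j)$ is an equalizer. A \emph{locally ringed lattice} $(L,\mathcal F)$ is a lattice $L$ with a sheaf of rings $\mathcal F$ and, for every $u\in L$, a map $\mathcal D_u:\mathcal F(u)\to{\downarrow}u$ that is a support and satisfies, for all $s\in\mathcal F(u)$ and $w\le u$: $w\le\mathcal D_u(s)$ if and only if $s|_w$ is invertible in $\mathcal F(w)$. The family $\mathcal D$ is called the \emph{invertibility support}. A morphism $(L,\mathcal F)\to(M,\mathcal G)$ is a pair $(\pi^*,\pi^\sharp)$ of a bounded lattice homomorphism $\pi^*:L\to M$ and a natural transformation $\pi^\sharp:\mathcal F\Rightarrow\mathcal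 G\circ\pi^*$ with $\pi^*(\mathcal D_u(s))=\mathcal D_{\pi^*(u)}(\pi^\sharp(s))$ for all $u\in L$, $s\in\mathcal F(u)$. These form the category $\mathsf{LRDL}$. The \emph{Zariski lattice} $\mathcal L_R$ of a ring $R$ consists of the finite lists $D(f_1,\dots,f_n)$ of elements of $R$, two lists being identified when the ideals they generate have the same radical; it is ordered by inclusion of these radicals. Its \emph{structure sheaf} $\mathcal O_R$ is the right Kan extension to $\mathcal L_R$ of $D(f)\mapsto R[1/f]$ on the basic elements, so that $\mathcal O_R(D(f))\cong R[1/f]$ canonically, and its invertibility support is determined by $\mathcal D_{D(f)}(r/f^n)=D(fr)$. Let $\Gamma:\mathsf{LRDL}^{op}\to\mathsf{CommRing}^{op}$ be the global sections functor, $\Gamma(L,\mathcal F)=\mathcal F(1)$, $\Gamma(\pi)=\pi^\sharp_1$. Let $\mathsf{Spec}:\mathsf{CommRing}^{op}\to\mathsf{LRDL}^{op}$ send $R$ to $(\mathcal L_R,\mathcal O_R)$ with its invertibility support, and a ring homomorphism $\varphi:R\to A$ to the morphism whose lattice part is $D(f_1,\dots,f_n)\mapsto D(\varphi(f_1),\dots,\varphi(f_n))$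 and whose sheaf part on basic elements is the map $R[1/f]\to A[1/\varphi(f)]$ induced by $\varphi$. \textbf{Theorem.} $\mathsf{Spec}$ is right adjoint to $\Gamma$, and the counit $\Gamma\circ\mathsf{Spec}\Rightarrow\mathrm{id}$ of this adjunction is an isomorphism. -/

import Mathlib

universe u

open CategoryTheory Opposite

/-! ### The Zariski lattice -/

section ZariskiLattice

variable (R : Type u) [CommRing R]

/-- Two lists of generators are identified when they generate ideals with the same radical. -/
def zariskiSetoid : Setoid (List R) where
  r l m := (Ideal.span {x | x ∈ l}).radical = (Ideal.span {x | x ∈ m}).radical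
  iseqv := ⟨fun _ => rfl, fun h => h.symm, fun h k => h.trans k⟩

/-- The Zariski lattice: lists of generators modulo the radical of the generated ideal. -/
def ZariskiLattice : Type u := Quotient (zariskiSetoid R)

variable {R}

namespace ZariskiLattice

/-- The class `D(f₁, …, fₙ)` of a list of generators. -/
def mk (l : List R) : ZariskiLattice R := Quotient.mk (zariskiSetoid R) l

/-- The class `D(f)` of a single generator. -/
def D (f : R) : ZariskiLattice R := mk [f]

/-- The radical ideal `√⟨f₁, …, fₙ⟩` of an element `D(f₁, …, fₙ)`. -/
def toIdeal (a : ZariskiLattice R) : Ideal R :=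
  Quotient.lift (s := zariskiSetoid R) (fun l => (Ideal.span {x | x ∈ l}).radical)
    (fun _ _ h => h) a

theorem toIdeal_mk (l : List R) : (mk l).toIdeal = (Ideal.span {x | x ∈ l}).radical := rfl

theorem ind {p : ZariskiLattice R → Prop} (h : ∀ l, p (mk l)) (a : ZariskiLattice R) : p a :=
  Quotient.ind h a

theorem toIdeal_injective : Function.Injective (toIdeal (R := R)) := by
  intro a b
  induction a using ind with | h l =>
  induction b using ind with | h m =>
  exact fun h => Quotient.sound (s := zariskiSetoid R) h

theorem radical_toIdeal (a : ZariskiLattice R) : a.toIdeal.radical = a.toIdeal := by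
  induction a using ind with | h l => exact Ideal.radical_idem _

theorem span_append (l m : List R) :
    Ideal.span {x | x ∈ l ++ m} = Ideal.span {x | x ∈ l} ⊔ Ideal.span {x | x ∈ m} := by
  rw [← Ideal.span_union]
  congr 1
  ext x
  simp

theorem span_product (l m : List R) :
    Ideal.span {x | x ∈ (l ×ˢ m).map fun p => p.1 * p.2} =
      Ideal.span {x | x ∈ l} * Ideal.span {x | x ∈ m} := by
  rw [Ideal.span_mul_span']
  congr 1
  ext x
  constructor
  · intro h
    obtain ⟨⟨a, b⟩, hp, rfl⟩ := List.mem_map.mp h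
    obtain ⟨ha, hb⟩ := List.pair_mem_product.mp hp
    exact Set.mul_mem_mul ha hb
  · rintro ⟨a, ha, b, hb, rfl⟩
    exact List.mem_map.mpr ⟨(a, b), List.pair_mem_product.mpr ⟨ha, hb⟩, rfl⟩

theorem radical_sup_congr {I I' J J' : Ideal R} (h : I.radical = I'.radical)
    (k : J.radical = J'.radical) : (I ⊔ J).radical = (I' ⊔ J').radical := by
  rw [Ideal.radical_sup, h, k, ← Ideal.radical_sup]

/-- The join `D(f₁, …, fₙ) ⊔ D(g₁, …, gₘ) = D(f₁, …, fₙ, g₁, …, gₘ)`. -/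
def join : ZariskiLattice R → ZariskiLattice R → ZariskiLattice R :=
  Quotient.map₂ (sa := zariskiSetoid R) (sb := zariskiSetoid R) (sc := zariskiSetoid R)
    (fun l m => l ++ m) (by
    intro l l' h m m' k
    change (Ideal.span _).radical = (Ideal.span _).radical
    rw [span_append, span_append]
    exact radical_sup_congr h k)

/-- The meet `D(f₁, …, fₙ) ⊓ D(g₁, …, gₘ) = D(f₁g₁, …, fᵢgⱼ, …, fₙgₘ)`. -/
def meet : ZariskiLattice R → ZariskiLattice R → ZariskiLattice R :=
  Quotient.map₂ (sa := zariskiSetoid R) (sb := zariskiSetoid R) (sc := zariskiSetoid R)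
    (fun l m => (l ×ˢ m).map fun p => p.1 * p.2) (by
    intro l l' h m m' k
    change (Ideal.span _).radical = (Ideal.span _).radical
    rw [span_product, span_product, Ideal.radical_mul, Ideal.radical_mul]
    exact congrArg₂ (· ⊓ ·) h k)

theorem toIdeal_join (a b : ZariskiLattice R) :
    (join a b).toIdeal = (a.toIdeal ⊔ b.toIdeal).radical := by
  induction a using ind with | h l =>
  induction b using ind with | h m =>
  change (Ideal.span {x | x ∈ l ++ m}).radical = _
  rw [span_append, toIdeal_mk, toIdeal_mk, ← Ideal.radical_sup]

theorem toIdeal_meet (a b : ZariskiLattice R) :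
    (meet a b).toIdeal = a.toIdeal ⊓ b.toIdeal := by
  induction a using ind with | h l =>
  induction b using ind with | h m =>
  change (Ideal.span {x | x ∈ (l ×ˢ m).map fun p => p.1 * p.2}).radical = _
  rw [span_product, toIdeal_mk, toIdeal_mk, ← Ideal.radical_mul]

theorem sup_mul_sup_le (I J K : Ideal R) : (I ⊔ J) * (I ⊔ K) ≤ I ⊔ J ⊓ K := by
  rw [Ideal.sup_mul, Ideal.mul_sup J]
  refine sup_le ?_ (sup_le ?_ ?_)
  · exact le_trans Ideal.mul_le_left le_sup_left
  · exact le_trans Ideal.mul_le_right le_sup_left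
  · exact le_trans Ideal.mul_le_inf le_sup_right

/-- The order on the Zariski lattice is the inclusion of radical ideals. -/
instance : DistribLattice (ZariskiLattice R) where
  le a b := a.toIdeal ≤ b.toIdeal
  le_refl a := le_refl a.toIdeal
  le_trans a b c h k := le_trans (a := a.toIdeal) h k
  le_antisymm a b h k := toIdeal_injective (le_antisymm h k)
  sup := join
  inf := meet
  le_sup_left a b := by
    rw [toIdeal_join]
    exact le_sup_left.trans Ideal.le_radical
  le_sup_right a b := by
    rw [toIdeal_join]
    exact le_sup_right.trans Ideal.le_radical
  sup_le a b c h k := by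
    rw [toIdeal_join, ← radical_toIdeal c]
    exact Ideal.radical_mono (sup_le h k)
  inf_le_left a b := by
    rw [toIdeal_meet]
    exact inf_le_left
  inf_le_right a b := by
    rw [toIdeal_meet]
    exact inf_le_right
  le_inf a b c h k := by
    rw [toIdeal_meet]
    exact le_inf h k
  le_sup_inf a b c := by
    change (meet (join a b) (join a c)).toIdeal ≤ (join a (meet b c)).toIdeal
    rw [toIdeal_meet, toIdeal_join, toIdeal_join, toIdeal_join, toIdeal_meet, ← Ideal.radical_mul]
    exact Ideal.radical_mono (sup_mul_sup_le _ _ _)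

theorem mk_sup_mk (l m : List R) : mk l ⊔ mk m = mk (l ++ m) := rfl

theorem mk_inf_mk (l m : List R) : mk l ⊓ mk m = mk ((l ×ˢ m).map fun p => p.1 * p.2) := rfl

theorem toIdeal_sup (a b : ZariskiLattice R) :
    (a ⊔ b).toIdeal = (a.toIdeal ⊔ b.toIdeal).radical := toIdeal_join a b

theorem le_iff {a b : ZariskiLattice R} : a ≤ b ↔ a.toIdeal ≤ b.toIdeal := Iff.rfl

instance : BoundedOrder (ZariskiLattice R) where
  bot := mk []
  top := mk [1]
  bot_le a := by
    induction a using ind with | h l =>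
    rw [le_iff]
    exact Ideal.radical_mono (Ideal.span_mono (by simp))
  le_top a := by
    rw [le_iff, toIdeal_mk]
    refine le_trans ?_ Ideal.le_radical
    simp

theorem bot_def : (⊥ : ZariskiLattice R) = mk [] := rfl

theorem top_def : (⊤ : ZariskiLattice R) = D 1 := rfl

theorem toIdeal_D (f : R) : (D f).toIdeal = (Ideal.span {f}).radical := by
  rw [D, toIdeal_mk]
  simp

theorem D_le_iff {f : R} {a : ZariskiLattice R} : D f ≤ a ↔ f ∈ a.toIdeal := by
  rw [le_iff, toIdeal_D]
  constructor
  · exact fun h => h (Ideal.le_radical (Ideal.mem_span_singleton_self f))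
  · intro h
    rw [← radical_toIdeal a]
    exact Ideal.radical_mono ((Ideal.span_singleton_le_iff_mem _).mpr h)

theorem D_le_D_iff {f g : R} : D f ≤ D g ↔ ∃ n, g ∣ f ^ n := by
  rw [D_le_iff, toIdeal_D]
  simp [Ideal.mem_radical_iff, Ideal.mem_span_singleton]

theorem D_mul (f g : R) : D (f * g) = D f ⊓ D g := rfl

theorem D_zero : D (0 : R) = ⊥ := by
  rw [eq_bot_iff, D_le_iff]
  exact Ideal.zero_mem _

theorem D_add_le (f g : R) : D (f + g) ≤ D f ⊔ D g :=
  D_le_iff.mpr (Ideal.add_mem _ (D_le_iff.mp le_sup_left) (D_le_iff.mp le_sup_right))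

theorem D_mul_le_left (f g : R) : D (f * g) ≤ D f := by rw [D_mul]; exact inf_le_left

theorem D_mul_le_right (f g : R) : D (f * g) ≤ D g := by rw [D_mul]; exact inf_le_right

theorem mk_le_iff {l : List R} {a : ZariskiLattice R} : mk l ≤ a ↔ ∀ x ∈ l, D x ≤ a := by
  constructor
  · exact fun h x hx => D_le_iff.mpr (h (Ideal.le_radical (Ideal.subset_span hx)))
  · intro h
    rw [le_iff, toIdeal_mk, ← radical_toIdeal a]
    exact Ideal.radical_mono (Ideal.span_le.mpr fun x hx => D_le_iff.mp (h x hx))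

/-- The basic elements `D(f)` determine the order. -/
theorem le_of_D_le {a b : ZariskiLattice R} (h : ∀ f, D f ≤ a → D f ≤ b) : a ≤ b :=
  fun _ hf => D_le_iff.mp (h _ (D_le_iff.mpr hf))

/-- Every element is a finite join of basic elements. -/
theorem exists_eq_sup (a : ZariskiLattice R) :
    ∃ (n : ℕ) (f : Fin n → R), a = Finset.univ.sup fun i => D (f i) := by
  induction a using ind with | h l =>
  refine ⟨l.length, l.get, le_antisymm (mk_le_iff.mpr fun x hx => ?_) ?_⟩
  · obtain ⟨i, rfl⟩ := List.mem_iff_get.mp hx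
    exact Finset.le_sup (f := fun i => D (l.get i)) (Finset.mem_univ i)
  · exact Finset.sup_le fun i _ => mk_le_iff.mp le_rfl _ (List.get_mem l i)

/-- If the join of a finite family is above `D(f)`, then `f` lies in the radical of the ideal
generated by all `g` with `D(g)` below `D(f)` and below some member of the family. -/
theorem mem_radical_of_le_sup {n : ℕ} {u : Fin n → ZariskiLattice R} {f : R}
    (h : D f ≤ Finset.univ.sup u) :
    f ∈ (Ideal.span {g | D g ≤ D f ∧ ∃ i, D g ≤ u i}).radical := by
  have key : ∀ s : Finset (Fin n), (s.sup fun i => D f ⊓ u i).toIdeal ≤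
      (Ideal.span {g | D g ≤ D f ∧ ∃ i, D g ≤ u i}).radical := by
    intro s
    induction s using Finset.induction_on with
    | empty =>
      rw [Finset.sup_empty, bot_def, toIdeal_mk]
      exact Ideal.radical_mono (Ideal.span_mono (by simp))
    | insert i s _ ih =>
      rw [Finset.sup_insert, toIdeal_sup, ← Ideal.radical_idem (Ideal.span _)]
      refine Ideal.radical_mono (sup_le (fun g hg => ?_) ih)
      have hg' := D_le_iff.mpr hg
      exact Ideal.le_radical (Ideal.subset_span
        ⟨hg'.trans inf_le_left, i, hg'.trans inf_le_right⟩)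
  refine key Finset.univ (D_le_iff.mp ?_)
  rw [← Finset.sup_inf_distrib_left]
  exact le_inf le_rfl h

theorem D_le_sup_mul {n : ℕ} {f : Fin n → R} {g : R}
    (h : D g ≤ Finset.univ.sup fun i => D (f i)) :
    D g = Finset.univ.sup fun i => D (g * f i) := by
  simp only [D_mul]
  rw [← Finset.sup_inf_distrib_left]
  exact (inf_eq_left.mpr h).symm

section map

variable {A : Type u} [CommRing A]

theorem radical_map_le (φ : R →+* A) {l m : List R}
    (h : (Ideal.span {x | x ∈ l}).radical ≤ (Ideal.span {x | x ∈ m}).radical) :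
    (Ideal.span {x | x ∈ l.map φ}).radical ≤ (Ideal.span {x | x ∈ m.map φ}).radical := by
  rw [← Ideal.radical_idem (Ideal.span {x | x ∈ m.map φ})]
  refine Ideal.radical_mono (Ideal.span_le.mpr ?_)
  intro y hy
  obtain ⟨x, hx, rfl⟩ := List.mem_map.mp hy
  obtain ⟨n, hn⟩ := h (Ideal.le_radical (Ideal.subset_span hx))
  refine ⟨n, ?_⟩
  rw [← map_pow]
  have := Ideal.mem_map_of_mem φ hn
  rw [Ideal.map_span] at this
  refine Ideal.span_mono ?_ this
  rintro _ ⟨z, hz, rfl⟩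
  exact List.mem_map_of_mem hz

/-- The underlying function of `map`. -/
def mapFun (φ : R →+* A) : ZariskiLattice R → ZariskiLattice A :=
  Quotient.map (sa := zariskiSetoid R) (sb := zariskiSetoid A) (List.map φ) fun _ _ h =>
    le_antisymm (radical_map_le φ (le_of_eq h)) (radical_map_le φ (le_of_eq h.symm))

theorem mapFun_mk (φ : R →+* A) (l : List R) : mapFun φ (mk l) = mk (l.map φ) := rfl

/-- The lattice homomorphism induced by a ring homomorphism `φ`; it sends `D(f₁, …, fₙ)` to
`D(φ f₁, …, φ fₙ)`. -/
def map (φ : R →+* A) : BoundedLatticeHom (ZariskiLattice R) (ZariskiLattice A) where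
  toFun := mapFun φ
  map_sup' a b := by
    induction a using ind with | h l =>
    induction b using ind with | h m =>
    exact congrArg mk List.map_append
  map_inf' a b := by
    induction a using ind with | h l =>
    induction b using ind with | h m =>
    refine congrArg mk ?_
    rw [List.map_map]
    induction l with
    | nil => rfl
    | cons x l ih =>
      simp only [List.product_cons, List.map_append, List.map_cons, List.map_map, ih]
      congr 1
      refine List.map_congr_left fun y _ => ?_
      simp
  map_top' := by
    change mk [φ 1] = mk [1]
    rw [map_one]
  map_bot' := rfl

theorem map_mk (φ : R →+* A) (l : List R) : map φ (mk l) = mk (l.map φ) := rfl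

theorem map_D (φ : R →+* A) (f : R) : map φ (D f) = D (φ f) := rfl

end map

end ZariskiLattice

end ZariskiLattice

/-! ### Sheaves, supports and locally ringed lattices -/

/-- A support of a bounded (distributive) lattice on a ring. -/
structure IsSupport {R L : Type*} [CommRing R] [Lattice L] [BoundedOrder L] (d : R → L) :
    Prop where
  map_zero : d 0 = ⊥
  map_one : d 1 = ⊤
  map_mul : ∀ x y, d (x * y) = d x ⊓ d y
  map_add_le : ∀ x y, d (x + y) ≤ d x ⊔ d y

/-- The restriction map of a ring-valued presheaf on a poset. -/
def restrict {P : Type u} [Preorder P] (F : Pᵒᵖ ⥤ CommRingCat.{u}) {w v : P} (h : w ≤ v) :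
    F.obj (op v) →+* F.obj (op w) :=
  (F.map (homOfLE h).op).hom

theorem restrict_restrict {P : Type u} [Preorder P] (F : Pᵒᵖ ⥤ CommRingCat.{u}) {a b c : P}
    (h : a ≤ b) (k : b ≤ c) (s : F.obj (op c)) :
    restrict F h (restrict F k s) = restrict F (h.trans k) s := by
  have : F.map (homOfLE (h.trans k)).op = F.map (homOfLE k).op ≫ F.map (homOfLE h).op := by
    rw [← F.map_comp]
    rfl
  rw [restrict, restrict, restrict, this]
  rfl

theorem restrict_self {P : Type u} [Preorder P] (F : Pᵒᵖ ⥤ CommRingCat.{u}) {a : P}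
    (h : a ≤ a) (s : F.obj (op a)) : restrict F h s = s := by
  have : F.map (homOfLE h).op = 𝟙 _ := F.map_id _
  rw [restrict, this]
  rfl

/-- The sheaf condition for a ring-valued presheaf on a lattice: for every finite (possibly
empty) family with `x = ⋁ᵢ uᵢ`, the ring `F(x)` is the equalizer of
`∏ᵢ F(uᵢ) ⇉ ∏ᵢⱼ F(uᵢ ⊓ uⱼ)`. -/
def IsLatticeSheaf {L : Type u} [Lattice L] [OrderBot L] (F : Lᵒᵖ ⥤ CommRingCat.{u}) : Prop :=
  ∀ (n : ℕ) (x : L) (u : Fin n → L) (hx : x = Finset.univ.sup u) (s : ∀ i, F.obj (op (u i))),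
    (∀ i j, restrict F (inf_le_left : u i ⊓ u j ≤ u i) (s i) =
      restrict F (inf_le_right : u i ⊓ u j ≤ u j) (s j)) →
    ∃! t : F.obj (op x), ∀ i,
      restrict F (hx ▸ Finset.le_sup (Finset.mem_univ i) : u i ≤ x) t = s i

/-- `v ≤ u` is an invertibility supremum of the section `s` over `u`: it is the largest element
below `u` over which `s` becomes invertible. -/
def IsInvertibilitySup {P : Type u} [Preorder P] (F : Pᵒᵖ ⥤ CommRingCat.{u}) (u : P)
    (s : F.obj (op u)) (v : Set.Iic u) : Prop :=
  ∀ (w : P) (hw : w ≤ u), w ≤ v.1 ↔ IsUnit (restrict F hw s)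

/-- A ringed lattice: a bounded distributive lattice with a sheaf of commutative rings. -/
structure RDL where
  carrier : Type u
  [distribLattice : DistribLattice carrier]
  [boundedOrder : BoundedOrder carrier]
  presheaf : carrierᵒᵖ ⥤ CommRingCat.{u}
  isSheaf : IsLatticeSheaf presheaf

attribute [instance] RDL.distribLattice RDL.boundedOrder

/-- The direct image `π_* G = G ∘ π` of a presheaf along a lattice homomorphism. -/
abbrev directImage {L M : Type u} [Lattice L] [BoundedOrder L] [Lattice M] [BoundedOrder M]
    (p : BoundedLatticeHom L M) (G : Mᵒᵖ ⥤ CommRingCat.{u}) : Lᵒᵖ ⥤ CommRingCat.{u} :=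
  (OrderHomClass.mono p).functor.op ⋙ G

/-- A morphism of ringed lattices. -/
structure RDL.Hom (X Y : RDL.{u}) where
  base : BoundedLatticeHom X.carrier Y.carrier
  sharp : X.presheaf ⟶ directImage base Y.presheaf

/-- The component at `v` of the natural transformation belonging to a morphism. -/
def RDL.Hom.app {X Y : RDL.{u}} (p : X.Hom Y) (v : X.carrier) :
    X.presheaf.obj (op v) →+* Y.presheaf.obj (op (p.base v)) :=
  (p.sharp.app (op v)).hom

theorem RDL.Hom.app_restrict {X Y : RDL.{u}} (p : X.Hom Y) {w v : X.carrier} (h : w ≤ v)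
    (s : X.presheaf.obj (op v)) :
    p.app w (restrict X.presheaf h s) =
      restrict Y.presheaf (OrderHomClass.mono p.base h) (p.app v s) :=
  congrArg (fun k => k.hom s) (p.sharp.naturality (homOfLE h).op)

theorem RDL.Hom.ext' {X Y : RDL.{u}} {p q : X.Hom Y} (h : ∀ v, p.base v = q.base v)
    (k : ∀ v s, restrict Y.presheaf (h v).ge (p.app v s) = q.app v s) : p = q := by
  obtain ⟨p₁, p₂⟩ := p
  obtain ⟨q₁, q₂⟩ := q
  obtain rfl : p₁ = q₁ := DFunLike.ext _ _ h
  congr 1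
  ext v s
  have := k v.unop s
  rw [restrict_self] at this
  exact this

/-- The identity morphism of a ringed lattice. -/
def RDL.Hom.id (X : RDL.{u}) : X.Hom X where
  base := BoundedLatticeHom.id X.carrier
  sharp := { app := fun v => 𝟙 (X.presheaf.obj v) }

/-- The composition of morphisms of ringed lattices. -/
def RDL.Hom.comp {X Y Z : RDL.{u}} (p : X.Hom Y) (q : Y.Hom Z) : X.Hom Z where
  base := q.base.comp p.base
  sharp := p.sharp ≫ Functor.whiskerLeft (OrderHomClass.mono p.base).functor.op q.sharp

theorem RDL.Hom.id_comp {X Y : RDL.{u}} (p : X.Hom Y) : (RDL.Hom.id X).comp p = p :=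
  RDL.Hom.ext' (fun _ => rfl) fun _ _ => restrict_self _ _ _

theorem RDL.Hom.comp_id {X Y : RDL.{u}} (p : X.Hom Y) : p.comp (RDL.Hom.id Y) = p :=
  RDL.Hom.ext' (fun _ => rfl) fun _ _ => restrict_self _ _ _

theorem RDL.Hom.assoc {W X Y Z : RDL.{u}} (p : W.Hom X) (q : X.Hom Y) (r : Y.Hom Z) :
    (p.comp q).comp r = p.comp (q.comp r) :=
  RDL.Hom.ext' (fun _ => rfl) fun _ _ => restrict_self _ _ _

/-- A locally ringed lattice: a ringed lattice with an invertibility support `D`, that is, an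
invertibility map such that every `D u : F(u) → ↓u` is a support. -/
structure LRDL extends RDL.{u} where
  D : ∀ v : carrier, presheaf.obj (op v) → Set.Iic v
  isInvertibilitySup : ∀ v s, IsInvertibilitySup presheaf v s (D v s)
  isSupport : ∀ v, IsSupport (D v)

/-- A morphism of locally ringed lattices: a morphism of ringed lattices that commutes with the
invertibility supports. -/
structure LRDL.Hom (X Y : LRDL.{u}) extends RDL.Hom X.toRDL Y.toRDL where
  map_D : ∀ v s, base (X.D v s).1 = (Y.D (base v) (toHom.app v s)).1

theorem LRDL.Hom.ext' {X Y : LRDL.{u}} {p q : X.Hom Y} (h : p.toHom = q.toHom) : p = q := by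
  cases p
  cases q
  cases h
  rfl

instance : Category LRDL.{u} where
  Hom := LRDL.Hom
  id X := ⟨RDL.Hom.id X.toRDL, fun _ _ => rfl⟩
  comp p q := ⟨p.toHom.comp q.toHom, fun v s => by
    change q.base (p.base _) = _
    rw [p.map_D, q.map_D]
    rfl⟩
  id_comp p := LRDL.Hom.ext' p.toHom.id_comp
  comp_id p := LRDL.Hom.ext' p.toHom.comp_id
  assoc p q r := LRDL.Hom.ext' (p.toHom.assoc q.toHom r.toHom)

/-- The action of a morphism on global sections, `O_X(1) → O_Y(π(1)) = O_Y(1)`. -/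
def LRDL.Hom.globalMap {X Y : LRDL.{u}} (p : X.Hom Y) :
    X.presheaf.obj (op ⊤) →+* Y.presheaf.obj (op ⊤) :=
  (restrict Y.presheaf (map_top p.base).ge).comp (p.toHom.app ⊤)

/-- Global sections as a covariant functor from locally ringed lattices to rings. -/
def LRDL.globalSections : LRDL.{u} ⥤ CommRingCat.{u} where
  obj X := X.presheaf.obj (op ⊤)
  map p := CommRingCat.ofHom (LRDL.Hom.globalMap p)
  map_id X := by
    ext s
    exact restrict_self _ _ _
  map_comp {X Y Z} p q := by
    ext s
    change restrict Z.presheaf _ (RDL.Hom.app (LRDL.Hom.toHom q) _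
        (RDL.Hom.app (LRDL.Hom.toHom p) ⊤ s)) =
      restrict Z.presheaf _ (RDL.Hom.app (LRDL.Hom.toHom q) ⊤
        (restrict Y.presheaf _ (RDL.Hom.app (LRDL.Hom.toHom p) ⊤ s)))
    rw [RDL.Hom.app_restrict, restrict_restrict]

/-- The global sections functor `Γ` on opposite categories. -/
def LRDL.Gamma : LRDL.{u}ᵒᵖ ⥤ CommRingCat.{u}ᵒᵖ := LRDL.globalSections.op


/-! ### The structure sheaf -/

namespace ZariskiLattice

section Localization

variable {R : Type u} [CommRing R]

theorem isUnit_algebraMap_iff {f g : R} :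
    IsUnit (algebraMap R (Localization.Away g) f) ↔ D g ≤ D f := by
  rw [D_le_D_iff]
  exact IsLocalization.Away.algebraMap_isUnit_iff g

/-- The canonical map `R[1/f] → R[1/g]` for `D(g) ≤ D(f)`. -/
noncomputable def res {f g : R} (h : D g ≤ D f) :
    Localization.Away f →ₐ[R] Localization.Away g :=
  IsLocalization.Away.liftAlgHom f (f := Algebra.ofId R (Localization.Away g))
    (isUnit_algebraMap_iff.mpr h)

theorem algHom_eq {f : R} {A : Type*} [CommRing A] [Algebra R A]
    (p q : Localization.Away f →ₐ[R] A) : p = q :=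
  (IsLocalization.algHom_subsingleton (Submonoid.powers f)).elim p q

theorem res_res {f g k : R} (h : D g ≤ D f) (h' : D k ≤ D g) (x : Localization.Away f) :
    res h' (res h x) = res (h'.trans h) x :=
  congrArg (fun p => p x) (algHom_eq ((res h').comp (res h)) (res (h'.trans h)))

theorem res_self {f : R} (h : D f ≤ D f) (x : Localization.Away f) : res h x = x :=
  congrArg (fun p => p x) (algHom_eq (res h) (AlgHom.id R _))

/-- Every element of `R[1/f]` is a fraction `a / f ^ n`. -/
theorem exists_fraction {f : R} (x : Localization.Away f) :
    ∃ (n : ℕ) (a : R), f ^ n • x = algebraMap R _ a := by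
  obtain ⟨n, a, h⟩ := IsLocalization.Away.surj f x
  exact ⟨n, a, by rw [Algebra.smul_def, map_pow, mul_comm, h]⟩

theorem isUnit_pow (f : R) (n : ℕ) : IsUnit (algebraMap R (Localization.Away f) (f ^ n)) := by
  rw [map_pow]
  exact (IsLocalization.Away.algebraMap_isUnit f).pow n

theorem smul_pow_cancel {f : R} {n : ℕ} {x y : Localization.Away f}
    (h : f ^ n • x = f ^ n • y) : x = y := by
  rw [Algebra.smul_def, Algebra.smul_def] at h
  exact (isUnit_pow f n).mul_left_cancel h

theorem exists_smul_eq_zero {f g : R} (h : D g ≤ D f) {x : Localization.Away f}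
    (hx : res h x = 0) : ∃ n, g ^ n • x = 0 := by
  obtain ⟨k, a, ha⟩ := exists_fraction x
  have h₁ : algebraMap R (Localization.Away g) a = algebraMap R _ 0 := by
    rw [map_zero, ← (res h).commutes a, ← ha, map_smul, hx, smul_zero]
  obtain ⟨n, hn⟩ := IsLocalization.Away.exists_of_eq g h₁
  refine ⟨n, smul_pow_cancel (n := k) ?_⟩
  rw [smul_comm, ha, smul_zero, Algebra.smul_def, ← map_mul, hn, mul_zero, map_zero]

/-- Elements of `R[1/f]` are determined by their images on a cover of `D(f)`. -/
theorem away_separated {f : R} {S : Set R} (hS : ∀ g ∈ S, D g ≤ D f)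
    (hf : f ∈ (Ideal.span S).radical) {x y : Localization.Away f}
    (h : ∀ g (hg : g ∈ S), res (hS g hg) x = res (hS g hg) y) : x = y := by
  rw [← sub_eq_zero]
  have key : (Ideal.span S).radical ≤
      Ideal.radical (LinearMap.ker
        (LinearMap.toSpanSingleton R (Localization.Away f) (x - y))) := by
    refine Ideal.radical_le_radical_iff.mpr (Ideal.span_le.mpr fun g hg => ?_)
    obtain ⟨n, hn⟩ := exists_smul_eq_zero (hS g hg) (x := x - y) (by
      rw [map_sub, h g hg, sub_self])
    exact ⟨n, by simpa using hn⟩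
  obtain ⟨n, hn⟩ := key hf
  refine smul_pow_cancel (n := n) ?_
  rw [smul_zero]
  simpa using hn

/-- Gluing of elements of localizations, for a finite cover. -/
theorem away_glue_finite {f : R} (t : Finset R) (ht : ∀ g ∈ t, D g ≤ D f)
    (hf : f ∈ (Ideal.span (t : Set R)).radical) (b : ∀ g : R, Localization.Away g)
    (hb : ∀ g ∈ t, ∀ k ∈ t, res (D_mul_le_left g k) (b g) = res (D_mul_le_right g k) (b k)) :
    ∃ x : Localization.Away f, ∀ g (hg : g ∈ t), res (ht g hg) x = b g := by
  let J : Ideal R :=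
    { carrier := {r | ∃ z : Localization.Away f, ∀ g (hg : g ∈ t), res (ht g hg) z = r • b g}
      zero_mem' := ⟨0, fun g hg => by simp⟩
      add_mem' := by
        rintro r s ⟨z, hz⟩ ⟨w, hw⟩
        exact ⟨z + w, fun g hg => by rw [map_add, hz g hg, hw g hg, add_smul]⟩
      smul_mem' := by
        rintro r s ⟨z, hz⟩
        exact ⟨r • z, fun g hg => by rw [map_smul, hz g hg, smul_assoc]⟩ }
  have key : (Ideal.span (t : Set R)).radical ≤ J.radical := by
    refine Ideal.radical_le_radical_iff.mpr (Ideal.span_le.mpr fun k hk => ?_)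
    obtain ⟨m, a, ha⟩ := exists_fraction (b k)
    have h₁ : ∀ g ∈ t, ∃ n, k ^ n • (k ^ m • b g - algebraMap R _ a) = 0 := by
      intro g hg
      obtain ⟨n, hn⟩ := exists_smul_eq_zero (D_mul_le_left g k)
        (x := k ^ m • b g - algebraMap R _ a) (by
          rw [map_sub, map_smul, hb g hg k hk, ← map_smul, ha, AlgHom.commutes, AlgHom.commutes,
            sub_self])
      refine ⟨n, smul_pow_cancel (n := n) ?_⟩
      rw [smul_zero, ← mul_smul, ← mul_pow, hn]
    choose! n hn using h₁
    refine ⟨t.sup n + m, k ^ t.sup n • algebraMap R _ a, fun g hg => ?_⟩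
    have h₂ : k ^ t.sup n • (k ^ m • b g - algebraMap R _ a) = 0 := by
      rw [← Nat.sub_add_cancel (Finset.le_sup (f := n) hg), pow_add, mul_smul, hn g hg, smul_zero]
    rw [map_smul, AlgHom.commutes, pow_add, mul_smul]
    rw [smul_sub, sub_eq_zero] at h₂
    exact h₂.symm
  obtain ⟨n, z, hz⟩ := key hf
  obtain ⟨c, hc⟩ := (isUnit_pow f n).exists_right_inv
  refine ⟨c * z, fun g hg => ?_⟩
  rw [map_mul, hz g hg, Algebra.smul_def, ← mul_assoc, ← (res (ht g hg)).commutes, ← map_mul,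
    mul_comm c, hc, map_one, one_mul]

/-- Gluing of elements of localizations. -/
theorem away_glue {f : R} {S : Set R} (hS : ∀ g ∈ S, D g ≤ D f)
    (hf : f ∈ (Ideal.span S).radical) (b : ∀ g : R, Localization.Away g)
    (hb : ∀ g ∈ S, ∀ k ∈ S, res (D_mul_le_left g k) (b g) = res (D_mul_le_right g k) (b k)) :
    ∃ x : Localization.Away f, ∀ g (hg : g ∈ S), res (hS g hg) x = b g := by
  obtain ⟨n, hn⟩ := hf
  obtain ⟨t, htS, hnt⟩ := Submodule.mem_span_finite_of_mem_span hn
  have hft : f ∈ (Ideal.span (t : Set R)).radical := ⟨n, hnt⟩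
  obtain ⟨x, hx⟩ := away_glue_finite t (fun g hg => hS g (htS hg)) hft b
    (fun g hg k hk => hb g (htS hg) k (htS hk))
  refine ⟨x, fun g hg => ?_⟩
  refine away_separated (S := {r | ∃ k ∈ t, r = g * k}) ?_ ?_ ?_
  · rintro _ ⟨k, -, rfl⟩
    exact D_mul_le_left g k
  · have h₁ : g ∈ (Ideal.span (t : Set R)).radical := by
      have := D_le_iff.mp (hS g hg)
      rw [toIdeal_D] at this
      exact (Ideal.radical_le_radical_iff.mpr
        ((Ideal.span_singleton_le_iff_mem _).mpr hft)) this
    obtain ⟨m, hm⟩ := h₁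
    refine ⟨m + 1, ?_⟩
    rw [pow_succ']
    have h₂ := Ideal.mul_mem_mul (Ideal.mem_span_singleton_self g) hm
    rw [Ideal.span_mul_span'] at h₂
    refine Ideal.span_mono ?_ h₂
    rintro _ ⟨_, rfl, k, hk, rfl⟩
    exact ⟨k, hk, rfl⟩
  · rintro _ ⟨k, hk, rfl⟩
    rw [res_res, ← res_res (hS k (htS hk)) (D_mul_le_right g k), hx k hk]
    exact (hb g hg k (htS hk)).symm

end Localization

section StructureSheaf

variable (R : Type u) [CommRing R]

/-- The sections of the structure sheaf over `v`: compatible families of elements of `R[1/f]`,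
where `f` ranges over all `f` with `D(f) ≤ v`. This is the limit of `D(f) ↦ R[1/f]` over the
basic elements below `v`, i.e. the right Kan extension along the inclusion of the basis. -/
def sections (v : ZariskiLattice R) :
    Subalgebra R (∀ f : {f : R // D f ≤ v}, Localization.Away f.1) where
  carrier := {s | ∀ (f g : {f : R // D f ≤ v}) (h : D g.1 ≤ D f.1), res h (s f) = s g}
  mul_mem' hs ht f g h := by rw [Pi.mul_apply, Pi.mul_apply, map_mul, hs f g h, ht f g h]
  add_mem' hs ht f g h := by rw [Pi.add_apply, Pi.add_apply, map_add, hs f g h, ht f g h]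
  algebraMap_mem' r f g h := (res h).commutes r

/-- Restriction of compatible families. -/
def sectionsRestrict {w v : ZariskiLattice R} (h : w ≤ v) : sections R v →+* sections R w where
  toFun s := ⟨fun f => s.1 ⟨f.1, f.2.trans h⟩, fun f g k => s.2 ⟨f.1, _⟩ ⟨g.1, _⟩ k⟩
  map_one' := rfl
  map_mul' _ _ := rfl
  map_zero' := rfl
  map_add' _ _ := rfl

/-- The structure sheaf `O_R` on the Zariski lattice, with `O_R(D(f)) ≅ R[1/f]`. -/
def structureSheaf : (ZariskiLattice R)ᵒᵖ ⥤ CommRingCat.{u} where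
  obj v := CommRingCat.of (sections R v.unop)
  map h := CommRingCat.ofHom (sectionsRestrict R h.unop.le)
  map_id _ := rfl
  map_comp _ _ := rfl

variable {R}

/-- The value in `R[1/f]` of a section, for `D(f) ≤ v`. -/
def eval {v : ZariskiLattice R} (f : R) (h : D f ≤ v) :
    (structureSheaf R).obj (op v) →+* Localization.Away f where
  toFun s := s.1 ⟨f, h⟩
  map_one' := rfl
  map_mul' _ _ := rfl
  map_zero' := rfl
  map_add' _ _ := rfl

theorem res_eval {v : ZariskiLattice R} {f g : R} (hf : D f ≤ v) (h : D g ≤ D f)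
    (s : (structureSheaf R).obj (op v)) : res h (eval f hf s) = eval g (h.trans hf) s :=
  s.2 ⟨f, hf⟩ ⟨g, h.trans hf⟩ h

theorem eval_restrict {w v : ZariskiLattice R} (h : w ≤ v) {f : R} (hf : D f ≤ w)
    (s : (structureSheaf R).obj (op v)) :
    eval f hf (restrict (structureSheaf R) h s) = eval f (hf.trans h) s := rfl

theorem section_ext {v : ZariskiLattice R} {s t : (structureSheaf R).obj (op v)}
    (h : ∀ f (hf : D f ≤ v), eval f hf s = eval f hf t) : s = t :=
  Subtype.ext (funext fun f => h f.1 f.2)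

/-- The canonical map `R[1/f] → O_R(D(f))`, inverse to `eval`. -/
noncomputable def ofAway (f : R) : Localization.Away f →+* (structureSheaf R).obj (op (D f)) where
  toFun x := ⟨fun g => res g.2 x, fun g _ h => res_res g.2 h x⟩
  map_one' := Subtype.ext (funext fun g => map_one (res g.2))
  map_mul' x y := Subtype.ext (funext fun g => map_mul (res g.2) x y)
  map_zero' := Subtype.ext (funext fun g => map_zero (res g.2))
  map_add' x y := Subtype.ext (funext fun g => map_add (res g.2) x y)

theorem eval_ofAway {f g : R} (h : D g ≤ D f) (x : Localization.Away f) :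
    eval g h (ofAway f x) = res h x := rfl

/-- The canonical isomorphism `O_R(D(f)) ≅ R[1/f]`. -/
noncomputable def sectionsEquiv (f : R) :
    (structureSheaf R).obj (op (D f)) ≃+* Localization.Away f where
  __ := eval f le_rfl
  invFun := ofAway f
  left_inv s := section_ext fun g hg => by
    change res hg (eval f le_rfl s) = _
    rw [res_eval]
  right_inv x := res_self le_rfl x

theorem structureSheaf_isSheaf : IsLatticeSheaf (structureSheaf R) := by
  intro n x v hx s hs
  have hle : ∀ i, v i ≤ x := fun i => hx ▸ Finset.le_sup (Finset.mem_univ i)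
  have hcov : ∀ f, D f ≤ x → f ∈ (Ideal.span {g | D g ≤ D f ∧ ∃ i, D g ≤ v i}).radical :=
    fun f hf => mem_radical_of_le_sup (hx ▸ hf)
  have hs' : ∀ g i j (hi : D g ≤ v i) (hj : D g ≤ v j), eval g hi (s i) = eval g hj (s j) := by
    intro g i j hi hj
    have := congrArg (eval g (le_inf hi hj)) (hs i j)
    rwa [eval_restrict, eval_restrict] at this
  classical
  let b : ∀ g : R, Localization.Away g := fun g =>
    if h : ∃ i, D g ≤ v i then eval g h.choose_spec (s h.choose) else 0
  have hb : ∀ g i (hi : D g ≤ v i), b g = eval g hi (s i) := by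
    intro g i hi
    have h : ∃ i, D g ≤ v i := ⟨i, hi⟩
    simp only [b, dif_pos h]
    exact hs' g _ _ _ _
  have glue : ∀ f : {f // D f ≤ x}, ∃ y : Localization.Away f.1,
      ∀ g (hg : D g ≤ D f.1), (∃ i, D g ≤ v i) → res hg y = b g := by
    intro f
    obtain ⟨y, hy⟩ := away_glue (S := {g | D g ≤ D f.1 ∧ ∃ i, D g ≤ v i}) (fun g hg => hg.1)
      (hcov f.1 f.2) b (by
        rintro g ⟨-, i, hi⟩ k ⟨-, j, hj⟩
        rw [hb g i hi, hb k j hj, res_eval, res_eval]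
        exact hs' _ _ _ _ _)
    exact ⟨y, fun g hg hi => hy g ⟨hg, hi⟩⟩
  choose y hy using glue
  refine ⟨⟨y, ?_⟩, ?_, ?_⟩
  · intro f g h
    refine away_separated (S := {k | D k ≤ D g.1 ∧ ∃ i, D k ≤ v i}) (fun k hk => hk.1)
      (hcov g.1 g.2) fun k hk => ?_
    rw [res_res, hy f k _ hk.2, hy g k _ hk.2]
  · intro i
    refine section_ext fun f hf => ?_
    have := hy ⟨f, hf.trans (hle i)⟩ f le_rfl ⟨i, hf⟩
    rw [res_self, hb f i hf] at this
    exact this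
  · intro t ht
    refine section_ext fun f hf => ?_
    refine away_separated (S := {k | D k ≤ D f ∧ ∃ i, D k ≤ v i}) (fun k hk => hk.1)
      (hcov f hf) ?_
    rintro k ⟨hk, i, hi⟩
    refine Eq.trans ?_ ((hy ⟨f, hf⟩ k hk ⟨i, hi⟩).trans (hb k i hi)).symm
    rw [res_eval, ← ht i, eval_restrict]

end StructureSheaf

end ZariskiLattice

/-! ### The invertibility support of the structure sheaf -/

namespace ZariskiLattice

section Support

variable {R : Type u} [CommRing R]

theorem isUnit_away_iff {g : R} {x : Localization.Away g} {n : ℕ} {a : R}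
    (h : g ^ n • x = algebraMap R _ a) : IsUnit x ↔ D g ≤ D a := by
  rw [← isUnit_algebraMap_iff, ← h, Algebra.smul_def, IsUnit.mul_iff]
  exact (and_iff_right (isUnit_pow g n)).symm

theorem isUnit_section_iff {v : ZariskiLattice R} {s : (structureSheaf R).obj (op v)} :
    IsUnit s ↔ ∀ f (hf : D f ≤ v), IsUnit (eval f hf s) := by
  refine ⟨fun h f hf => h.map (eval f hf), fun h => ?_⟩
  choose y hy using fun f : {f // D f ≤ v} => (h f.1 f.2).exists_right_inv
  let t : (structureSheaf R).obj (op v) := ⟨y, fun f g k => by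
    refine (h g.1 g.2).mul_left_cancel ?_
    rw [hy g, ← res_eval f.2 k, ← map_mul, hy f, map_one]⟩
  exact IsUnit.of_mul_eq_one t (section_ext fun f hf => hy ⟨f, hf⟩)

theorem isUnit_of_cover {g : R} {x : Localization.Away g} {n : ℕ} {f : Fin n → R}
    (hg : D g ≤ Finset.univ.sup fun i => D (f i))
    (hx : ∀ i, IsUnit (res (D_mul_le_left g (f i)) x)) : IsUnit x := by
  obtain ⟨m, a, ha⟩ := exists_fraction x
  rw [isUnit_away_iff ha, D_le_sup_mul hg]
  refine Finset.sup_le fun i _ => isUnit_algebraMap_iff.mp ?_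
  rw [← (res (D_mul_le_left g (f i))).commutes, ← ha, Algebra.smul_def, map_mul]
  exact ((isUnit_pow g m).map _).mul (hx i)

/-- For `v = D(f₁, …, fₙ)` and a section `s` with `s = aᵢ / fᵢ ^ kᵢ` over `D(fᵢ)`, the
invertibility supremum of `s` is `⋁ᵢ D(fᵢ aᵢ)`. -/
theorem exists_support (v : ZariskiLattice R) (s : (structureSheaf R).obj (op v)) :
    ∃ d : Set.Iic v, ∀ g (hg : D g ≤ v), D g ≤ d.1 ↔ IsUnit (eval g hg s) := by
  obtain ⟨n, f, rfl⟩ := exists_eq_sup v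
  have hf : ∀ i, D (f i) ≤ Finset.univ.sup fun i => D (f i) := fun i =>
    Finset.le_sup (f := fun i => D (f i)) (Finset.mem_univ i)
  choose k a ha using fun i => exists_fraction (eval (f i) (hf i) s)
  have hu : ∀ g i (hg : D g ≤ D (f i)),
      IsUnit (eval g (hg.trans (hf i)) s) ↔ D g ≤ D (a i) := by
    intro g i hg
    have h₁ : algebraMap R (Localization.Away g) (f i ^ k i) * eval g (hg.trans (hf i)) s =
        algebraMap R _ (a i) := by
      rw [← (res hg).commutes (a i), ← ha i, map_smul, res_eval, Algebra.smul_def]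
    rw [← isUnit_algebraMap_iff, ← h₁, IsUnit.mul_iff]
    refine (and_iff_right ?_).symm
    rw [map_pow]
    exact (isUnit_algebraMap_iff.mpr hg).pow _
  refine ⟨⟨Finset.univ.sup fun i => D (f i * a i), Finset.sup_le fun i _ =>
    (D_mul_le_left _ _).trans (hf i)⟩, fun g hg => ⟨fun h => ?_, fun h => ?_⟩⟩
  · refine isUnit_of_cover h fun i => ?_
    rw [res_eval]
    have h₁ : D (g * (f i * a i)) ≤ D (f i) :=
      (D_mul_le_right _ _).trans (D_mul_le_left _ _)
    exact (hu _ i h₁).mpr ((D_mul_le_right _ _).trans (D_mul_le_right _ _))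
  · rw [D_le_sup_mul hg]
    refine Finset.sup_mono_fun fun i _ => ?_
    have h₁ : IsUnit (eval (g * f i) ((D_mul_le_left _ _).trans hg) s) := by
      rw [← res_eval hg (D_mul_le_left _ _)]
      exact h.map (res (D_mul_le_left g (f i)))
    rw [D_mul (f i)]
    exact le_inf (D_mul_le_right _ _) ((hu _ i (D_mul_le_right _ _)).mp h₁)

/-- The invertibility support of the structure sheaf; it is uniquely determined by
`D_le_support_iff`, and it sends a section `r / f ^ n` over `D(f)` to `D(r) ⊓ D(f)`. -/
noncomputable def support (v : ZariskiLattice R) (s : (structureSheaf R).obj (op v)) :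
    Set.Iic v := (exists_support v s).choose

theorem D_le_support_iff {v : ZariskiLattice R} {s : (structureSheaf R).obj (op v)} {g : R}
    (hg : D g ≤ v) : D g ≤ (support v s).1 ↔ IsUnit (eval g hg s) :=
  (exists_support v s).choose_spec g hg

theorem support_ofAway {f r : R} {n : ℕ} {x : Localization.Away f}
    (h : f ^ n • x = algebraMap R _ r) : (support (D f) (ofAway f x)).1 = D r ⊓ D f := by
  have key : ∀ g (hg : D g ≤ D f), IsUnit (eval g hg (ofAway f x)) ↔ D g ≤ D r := by
    intro g hg
    rw [eval_ofAway, ← isUnit_algebraMap_iff, ← (res hg).commutes r, ← h, map_smul,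
      Algebra.smul_def, IsUnit.mul_iff, map_pow]
    exact (and_iff_right ((isUnit_algebraMap_iff.mpr hg).pow _)).symm
  refine le_antisymm (le_of_D_le fun g hg => ?_) (le_of_D_le fun g hg => ?_)
  · have hg' := hg.trans (support (D f) (ofAway f x)).2
    exact le_inf ((key g hg').mp ((D_le_support_iff hg').mp hg)) hg'
  · exact (D_le_support_iff (hg.trans inf_le_right)).mpr ((key g _).mpr (hg.trans inf_le_left))

theorem support_isInvertibilitySup (v : ZariskiLattice R) (s : (structureSheaf R).obj (op v)) :
    IsInvertibilitySup (structureSheaf R) v s (support v s) := by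
  intro w hw
  rw [isUnit_section_iff]
  constructor
  · intro h f hf
    rw [eval_restrict]
    exact (D_le_support_iff _).mp (hf.trans h)
  · intro h
    exact le_of_D_le fun f hf => (D_le_support_iff (hf.trans hw)).mpr (h f hf)

theorem support_isSupport (v : ZariskiLattice R) : IsSupport (support (R := R) v) where
  map_zero := by
    refine le_bot_iff.mp (le_of_D_le fun g hg => ?_)
    have hg' := hg.trans (support v 0).2
    have h₁ := (D_le_support_iff hg').mp hg
    rw [map_zero, ← map_zero (algebraMap R _), isUnit_algebraMap_iff, D_zero] at h₁
    exact h₁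
  map_one := by
    refine top_le_iff.mp (le_of_D_le fun g hg => ?_)
    refine (D_le_support_iff hg).mpr ?_
    rw [map_one]
    exact isUnit_one
  map_mul x y := by
    refine le_antisymm (le_of_D_le fun g hg => ?_) (le_of_D_le fun g hg => ?_)
    · have hg' := hg.trans (support v (x * y)).2
      have h₁ := (D_le_support_iff hg').mp hg
      rw [_root_.map_mul, IsUnit.mul_iff] at h₁
      exact le_inf ((D_le_support_iff hg').mpr h₁.1) ((D_le_support_iff hg').mpr h₁.2)
    · have hx : D g ≤ (support v x).1 := hg.trans inf_le_left
      have hy : D g ≤ (support v y).1 := hg.trans inf_le_right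
      have hg' := hx.trans (support v x).2
      refine (D_le_support_iff hg').mpr ?_
      rw [_root_.map_mul]
      exact ((D_le_support_iff hg').mp hx).mul ((D_le_support_iff hg').mp hy)
  map_add_le x y := by
    refine le_of_D_le fun g hg => ?_
    change D g ≤ (support v x).1 ⊔ (support v y).1
    have hg' := hg.trans (support v (x + y)).2
    have h₁ := (D_le_support_iff hg').mp hg
    have key : ∀ z : (structureSheaf R).obj (op v), ∀ n a,
        g ^ n • eval g hg' z = algebraMap R _ a → D g ⊓ D a ≤ (support v z).1 := by
      intro z n a ha
      rw [← D_mul]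
      refine (D_le_support_iff ((D_mul_le_left _ _).trans hg')).mpr ?_
      rw [← res_eval hg' (D_mul_le_left g a)]
      have h₂ : IsUnit (algebraMap R (Localization.Away (g * a)) a) :=
        isUnit_algebraMap_iff.mpr (D_mul_le_right g a)
      rw [← (res (D_mul_le_left g a)).commutes, ← ha, Algebra.smul_def, _root_.map_mul,
        IsUnit.mul_iff] at h₂
      exact h₂.2
    obtain ⟨m, a, ha⟩ := exists_fraction (eval g hg' x)
    obtain ⟨n, b, hb⟩ := exists_fraction (eval g hg' y)
    have ha' : g ^ (n + m) • eval g hg' x = algebraMap R _ (g ^ n * a) := by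
      rw [pow_add, mul_smul, ha, Algebra.smul_def, ← _root_.map_mul]
    have hb' : g ^ (n + m) • eval g hg' y = algebraMap R _ (g ^ m * b) := by
      rw [add_comm, pow_add, mul_smul, hb, Algebra.smul_def, ← _root_.map_mul]
    have hab : g ^ (n + m) • eval g hg' (x + y) = algebraMap R _ (g ^ n * a + g ^ m * b) := by
      rw [map_add, smul_add, ha', hb', map_add]
    rw [isUnit_away_iff hab] at h₁
    calc D g ≤ D g ⊓ (D (g ^ n * a) ⊔ D (g ^ m * b)) := le_inf le_rfl (h₁.trans (D_add_le _ _))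
      _ = D g ⊓ D (g ^ n * a) ⊔ D g ⊓ D (g ^ m * b) := inf_sup_left _ _ _
      _ ≤ (support v x).1 ⊔ (support v y).1 := sup_le_sup (key x _ _ ha') (key y _ _ hb')

end Support

end ZariskiLattice

/-! ### The spectrum functor -/

/-- The constructive spectrum of a ring: the Zariski lattice with the structure sheaf and the
invertibility support. -/
noncomputable def LRDL.specObj (R : Type u) [CommRing R] : LRDL.{u} where
  carrier := ZariskiLattice R
  presheaf := ZariskiLattice.structureSheaf R
  isSheaf := ZariskiLattice.structureSheaf_isSheaf
  D := ZariskiLattice.support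
  isInvertibilitySup := ZariskiLattice.support_isInvertibilitySup
  isSupport := ZariskiLattice.support_isSupport

namespace ZariskiLattice

section Functoriality

variable {R A : Type u} [CommRing R] [CommRing A] (φ : R →+* A)

/-- The map `R[1/f] → A[1/φ(f)]` induced by `φ`. -/
noncomputable def awayMap (f : R) : Localization.Away f →+* Localization.Away (φ f) :=
  IsLocalization.Away.lift f (g := (algebraMap A (Localization.Away (φ f))).comp φ)
    (IsLocalization.Away.algebraMap_isUnit (φ f))

theorem awayMap_algebraMap (f r : R) :
    awayMap φ f (algebraMap R _ r) = algebraMap A _ (φ r) :=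
  IsLocalization.Away.lift_eq f (g := (algebraMap A (Localization.Away (φ f))).comp φ)
    (IsLocalization.Away.algebraMap_isUnit (φ f)) r

theorem away_ringHom_ext {f : R} {B : Type*} [CommRing B] {p q : Localization.Away f →+* B}
    (h : ∀ r, p (algebraMap R _ r) = q (algebraMap R _ r)) : p = q :=
  IsLocalization.ringHom_ext (Submonoid.powers f) (RingHom.ext h)

theorem D_map_le {f : R} {v : ZariskiLattice R} (h : D f ≤ v) : D (φ f) ≤ map φ v :=
  OrderHomClass.mono (map φ) h

theorem res_awayMap {f g : R} (h : D g ≤ D f) (x : Localization.Away f) :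
    res (D_map_le φ h : D (φ g) ≤ D (φ f)) (awayMap φ f x) = awayMap φ g (res h x) := by
  have : (res (D_map_le φ h : D (φ g) ≤ D (φ f))).toRingHom.comp (awayMap φ f) =
      (awayMap φ g).comp (res h).toRingHom := by
    refine away_ringHom_ext fun r => ?_
    change res (D_map_le φ h) (awayMap φ f (algebraMap R _ r)) = awayMap φ g (res h (algebraMap R _ r))
    rw [awayMap_algebraMap, AlgHom.commutes, AlgHom.commutes, awayMap_algebraMap]
  exact congrArg (fun p => p x) this

theorem map_exists_sup (v : ZariskiLattice R) : ∃ (n : ℕ) (f : Fin n → R),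
    (∀ i, D (f i) ≤ v) ∧ map φ v = Finset.univ.sup fun i => D (φ (f i)) := by
  obtain ⟨n, f, rfl⟩ := exists_eq_sup v
  refine ⟨n, f, fun i => Finset.le_sup (f := fun i => D (f i)) (Finset.mem_univ i), ?_⟩
  rw [map_finset_sup]
  rfl

/-- A section over `φ(v)` is determined by its values on the basic elements `D(φ f)` with
`D(f) ≤ v`. -/
theorem map_section_ext {v : ZariskiLattice R} {s t : (structureSheaf A).obj (op (map φ v))}
    (h : ∀ f (hf : D f ≤ v), eval (φ f) (D_map_le φ hf) s = eval (φ f) (D_map_le φ hf) t) :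
    s = t := by
  obtain ⟨n, f, hf, hv⟩ := map_exists_sup φ v
  refine section_ext fun g hg => ?_
  refine away_separated (fun k hk => hk.1) (mem_radical_of_le_sup (hv ▸ hg)) ?_
  rintro k ⟨hk, i, hi⟩
  rw [res_eval, res_eval, ← res_eval (D_map_le φ (hf i)) hi, h (f i) (hf i), res_eval]

theorem exists_sharp (v : ZariskiLattice R) (s : (structureSheaf R).obj (op v)) :
    ∃ t : (structureSheaf A).obj (op (map φ v)), ∀ f (hf : D f ≤ v),
      eval (φ f) (D_map_le φ hf) t = awayMap φ f (eval f hf s) := by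
  obtain ⟨n, f, hf, hv⟩ := map_exists_sup φ v
  have key : ∀ a b g (ha : D a ≤ v) (hb : D b ≤ v) (hga : D g ≤ D (φ a)) (hgb : D g ≤ D (φ b)),
      res hga (awayMap φ a (eval a ha s)) = res hgb (awayMap φ b (eval b hb s)) := by
    intro a b g ha hb hga hgb
    have hg : D g ≤ D (φ (a * b)) := by
      rw [map_mul, D_mul]
      exact le_inf hga hgb
    rw [← res_res (D_map_le φ (D_mul_le_left a b)) hg,
      ← res_res (D_map_le φ (D_mul_le_right a b)) hg, res_awayMap φ (D_mul_le_left a b),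
      res_awayMap φ (D_mul_le_right a b), res_eval, res_eval]
  obtain ⟨t, ht, -⟩ := structureSheaf_isSheaf n (map φ v) (fun i => D (φ (f i))) hv
    (fun i => ofAway (φ (f i)) (awayMap φ (f i) (eval (f i) (hf i) s))) (by
      intro i j
      refine section_ext fun g hg => ?_
      rw [eval_restrict, eval_restrict, eval_ofAway, eval_ofAway]
      exact key _ _ _ _ _ _ _)
  refine ⟨t, fun g hg => ?_⟩
  refine away_separated (fun k hk => hk.1) (mem_radical_of_le_sup (hv ▸ D_map_le φ hg)) ?_
  rintro k ⟨hk, i, hi⟩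
  have h₁ := congrArg (eval k hi) (ht i)
  rw [eval_restrict, eval_ofAway] at h₁
  rw [res_eval, h₁]
  exact key _ _ _ _ _ _ _

/-- The component at `v` of `Spec(φ)^♯`. It is the unique section-wise extension of the maps
`R[1/f] → A[1/φ(f)]` for basic elements `D(f) ≤ v`. -/
noncomputable def sharp (v : ZariskiLattice R) :
    (structureSheaf R).obj (op v) →+* (structureSheaf A).obj (op (map φ v)) where
  toFun s := (exists_sharp φ v s).choose
  map_one' := map_section_ext φ fun f hf => by
    rw [(exists_sharp φ v 1).choose_spec f hf, map_one, map_one, map_one]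
  map_mul' s t := map_section_ext φ fun f hf => by
    rw [(exists_sharp φ v (s * t)).choose_spec f hf, map_mul, map_mul, map_mul,
      (exists_sharp φ v s).choose_spec f hf, (exists_sharp φ v t).choose_spec f hf]
  map_zero' := map_section_ext φ fun f hf => by
    rw [(exists_sharp φ v 0).choose_spec f hf, map_zero, map_zero, map_zero]
  map_add' s t := map_section_ext φ fun f hf => by
    rw [(exists_sharp φ v (s + t)).choose_spec f hf, map_add, map_add, map_add,
      (exists_sharp φ v s).choose_spec f hf, (exists_sharp φ v t).choose_spec f hf]

theorem eval_sharp {v : ZariskiLattice R} (s : (structureSheaf R).obj (op v)) {f : R}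
    (hf : D f ≤ v) : eval (φ f) (D_map_le φ hf) (sharp φ v s) = awayMap φ f (eval f hf s) :=
  (exists_sharp φ v s).choose_spec f hf

theorem sharp_restrict {w v : ZariskiLattice R} (h : w ≤ v)
    (s : (structureSheaf R).obj (op v)) :
    sharp φ w (restrict (structureSheaf R) h s) =
      restrict (structureSheaf A) (OrderHomClass.mono (map φ) h) (sharp φ v s) := by
  refine map_section_ext φ fun f hf => ?_
  rw [eval_sharp φ _ hf, eval_restrict, eval_restrict, eval_sharp φ s (hf.trans h)]

theorem map_support (v : ZariskiLattice R) (s : (structureSheaf R).obj (op v)) :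
    map φ (support v s).1 = (support (map φ v) (sharp φ v s)).1 := by
  refine le_antisymm ?_ (le_of_D_le fun g hg => ?_)
  · refine (support_isInvertibilitySup _ _ _ (OrderHomClass.mono (map φ) (support v s).2)).mpr ?_
    rw [← sharp_restrict]
    exact ((support_isInvertibilitySup v s _ (support v s).2).mp le_rfl).map _
  · obtain ⟨n, f, hf, hv⟩ := map_exists_sup φ v
    have hg' := hg.trans (support (map φ v) (sharp φ v s)).2
    have hu := (D_le_support_iff hg').mp hg
    rw [D_le_sup_mul (hv ▸ hg')]
    refine Finset.sup_le fun i _ => ?_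
    obtain ⟨k, a, ha⟩ := exists_fraction (eval (f i) (hf i) s)
    have h₁ : D (f i * a) ≤ (support v s).1 := by
      refine (D_le_support_iff ((D_mul_le_left _ _).trans (hf i))).mpr ?_
      rw [← res_eval (hf i) (D_mul_le_left _ _)]
      have h₂ : IsUnit (algebraMap R (Localization.Away (f i * a)) a) :=
        isUnit_algebraMap_iff.mpr (D_mul_le_right _ _)
      rw [← (res (D_mul_le_left (f i) a)).commutes, ← ha, Algebra.smul_def, map_mul,
        IsUnit.mul_iff] at h₂
      exact h₂.2
    refine le_trans ?_ (D_map_le φ h₁)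
    rw [map_mul, D_mul (φ (f i))]
    refine le_inf (D_mul_le_right _ _) (isUnit_algebraMap_iff.mp ?_)
    have h₃ : IsUnit (eval (g * φ (f i)) ((D_mul_le_left _ _).trans hg') (sharp φ v s)) := by
      rw [← res_eval hg' (D_mul_le_left _ _)]
      exact hu.map (res (D_mul_le_left g (φ (f i))))
    rw [← res_eval (D_map_le φ (hf i)) (D_mul_le_right _ _), eval_sharp φ s (hf i)] at h₃
    rw [← (res (D_mul_le_right g (φ (f i)))).commutes, ← awayMap_algebraMap, ← ha,
      Algebra.smul_def, map_mul, map_mul, awayMap_algebraMap, map_pow, AlgHom.commutes]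
    refine IsUnit.mul ?_ h₃
    rw [map_pow]
    exact (isUnit_algebraMap_iff.mpr (D_mul_le_right _ _)).pow _

end Functoriality

end ZariskiLattice

/-- The morphism of spectra induced by a ring homomorphism. -/
noncomputable def LRDL.specMap {R A : Type u} [CommRing R] [CommRing A] (φ : R →+* A) :
    (LRDL.specObj R).Hom (LRDL.specObj A) where
  base := ZariskiLattice.map φ
  sharp :=
    { app := fun v => CommRingCat.ofHom (ZariskiLattice.sharp φ v.unop)
      naturality := fun _ _ h => CommRingCat.hom_ext
        (RingHom.ext fun s => ZariskiLattice.sharp_restrict φ h.unop.le s) }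
  map_D := ZariskiLattice.map_support φ

theorem ZariskiLattice.awayMap_id {R : Type u} [CommRing R] (f : R)
    (x : Localization.Away f) : ZariskiLattice.awayMap (RingHom.id R) f x = x := by
  have : ZariskiLattice.awayMap (RingHom.id R) f = RingHom.id _ :=
    ZariskiLattice.away_ringHom_ext fun r => ZariskiLattice.awayMap_algebraMap _ _ _
  exact congrArg (fun p => p x) this

theorem ZariskiLattice.awayMap_comp {R A B : Type u} [CommRing R] [CommRing A] [CommRing B]
    (φ : R →+* A) (ψ : A →+* B) (f : R) (x : Localization.Away f) :
    ZariskiLattice.awayMap (ψ.comp φ) f x =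
      ZariskiLattice.awayMap ψ (φ f) (ZariskiLattice.awayMap φ f x) := by
  have : ZariskiLattice.awayMap (ψ.comp φ) f =
      (ZariskiLattice.awayMap ψ (φ f)).comp (ZariskiLattice.awayMap φ f) := by
    refine ZariskiLattice.away_ringHom_ext fun r => ?_
    refine (ZariskiLattice.awayMap_algebraMap (ψ.comp φ) f r).trans ?_
    refine (ZariskiLattice.awayMap_algebraMap ψ (φ f) (φ r)).symm.trans ?_
    exact congrArg _ (ZariskiLattice.awayMap_algebraMap φ f r).symm
  exact congrArg (fun p => p x) this

theorem ZariskiLattice.map_id_apply {R : Type u} [CommRing R] (v : ZariskiLattice R) :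
    ZariskiLattice.map (RingHom.id R) v = v := by
  induction v using ZariskiLattice.ind with | h l =>
  exact congrArg ZariskiLattice.mk (List.map_id l)

theorem ZariskiLattice.map_comp_apply {R A B : Type u} [CommRing R] [CommRing A] [CommRing B]
    (φ : R →+* A) (ψ : A →+* B) (v : ZariskiLattice R) :
    ZariskiLattice.map (ψ.comp φ) v = ZariskiLattice.map ψ (ZariskiLattice.map φ v) := by
  induction v using ZariskiLattice.ind with | h l =>
  exact congrArg ZariskiLattice.mk (List.map_map (g := ψ) (f := φ)).symm

theorem LRDL.specMap_id (R : Type u) [CommRing R] :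
    LRDL.specMap (RingHom.id R) = 𝟙 (LRDL.specObj R) := by
  refine LRDL.Hom.ext' (RDL.Hom.ext' ZariskiLattice.map_id_apply fun v s => ?_)
  refine ZariskiLattice.section_ext fun f hf => ?_
  refine Eq.trans ?_ (ZariskiLattice.awayMap_id f (ZariskiLattice.eval f hf s))
  exact ZariskiLattice.eval_sharp (RingHom.id R) s hf

theorem LRDL.specMap_comp {R A B : Type u} [CommRing R] [CommRing A] [CommRing B]
    (φ : R →+* A) (ψ : A →+* B) : LRDL.specMap (ψ.comp φ) =
      (show LRDL.specObj R ⟶ LRDL.specObj A from LRDL.specMap φ) ≫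
        (show LRDL.specObj A ⟶ LRDL.specObj B from LRDL.specMap ψ) := by
  refine Eq.symm (LRDL.Hom.ext' (RDL.Hom.ext'
    (fun v => (ZariskiLattice.map_comp_apply φ ψ v).symm) fun v s => ?_))
  refine ZariskiLattice.map_section_ext (ψ.comp φ) fun f hf => ?_
  refine Eq.trans ?_ (ZariskiLattice.eval_sharp (ψ.comp φ) s hf).symm
  refine Eq.trans ?_ (ZariskiLattice.awayMap_comp φ ψ f _).symm
  refine Eq.trans ?_ (congrArg _ (ZariskiLattice.eval_sharp φ s hf))
  exact ZariskiLattice.eval_sharp ψ (ZariskiLattice.sharp φ v s)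
    (ZariskiLattice.D_map_le φ hf)

/-- The constructive spectrum as a covariant functor from rings to locally ringed lattices. -/
noncomputable def LRDL.spec : CommRingCat.{u} ⥤ LRDL.{u} where
  obj R := LRDL.specObj R
  map φ := LRDL.specMap φ.hom
  map_id R := LRDL.specMap_id R
  map_comp φ ψ := LRDL.specMap_comp φ.hom ψ.hom

/-- The spectrum functor `Spec` on opposite categories. -/
noncomputable def LRDL.Spec : CommRingCat.{u}ᵒᵖ ⥤ LRDL.{u}ᵒᵖ := LRDL.spec.op

/-! ### Lattice homomorphisms out of the Zariski lattice -/

namespace IsSupport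

variable {R L : Type*} [CommRing R] [DistribLattice L] [BoundedOrder L] {d : R → L}

/-! Without the opposites, the claim is that morphisms `Spec R → X` in `LRDL` correspond naturally
to ring homomorphisms `R → Γ(X)`, and that the unit `R → Γ(Spec R)` is an isomorphism. A morphism
`p` is sent to the composite of `R → O_R(⊤)` with the action of `p` on global sections
(`ringHomOf`).

Existence: given `φ : R → Γ(X)`, the map `f ↦ D_⊤(φ f)` is a support, and the Zariski lattice
carries the universal support (`lift`); this gives the lattice part `π`, with `π(D(f)) = D_⊤(φ f)`.
Over that element `φ f` is invertible, so `φ` induces `R[1/f] → F(π(D(f)))`. These maps are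
compatible because a homomorphism out of a localization is determined on `R`. Since every `v` is a
finite join of basic elements and `π` preserves it, the sheaf condition on `X` extends them to all
`v` (`exists_sharpOf`). The result commutes with the supports because, on `D(f)`, a section is a
fraction `a / f ^ k`, invertible exactly where `a` is (`baseOf_support`).

Uniqueness: commuting with the supports forces `π(D(f)) = D_⊤(φ f)` (`base_eq`); the sheaf part is
then determined on basic elements by the universal property of `R[1/f]`, and everywhere by
separatedness (`ringHomOf_injective`).

The unit is an isomorphism because `⊤ = D(1)` and `O_R(D(1)) ≅ R[1/1] ≅ R`. Passing to opposite
categories turns this unit into the counit. -/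

theorem le_map_pow (hd : IsSupport d) (x : R) (n : ℕ) : d x ≤ d (x ^ n) := by
  induction n with
  | zero => rw [pow_zero, hd.map_one]; exact le_top
  | succ n ih => rw [pow_succ, hd.map_mul]; exact le_inf ih le_rfl

/-- The ideal of all elements whose support lies below `a`. -/
def idealBelow (hd : IsSupport d) (a : L) : Ideal R where
  carrier := {x | d x ≤ a}
  zero_mem' := by
    change d 0 ≤ a
    rw [hd.map_zero]
    exact bot_le
  add_mem' h k := (hd.map_add_le _ _).trans (sup_le h k)
  smul_mem' c x h := by
    change d (c * x) ≤ a
    rw [hd.map_mul]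
    exact inf_le_right.trans h

/-- The elements with support below `a` form an ideal, and `d x ≤ d (x ^ n)` makes that ideal
radical. Hence a support depends only on radicals of ideals, which is what lets it descend to the
Zariski lattice. -/
theorem le_of_mem_radical_span (hd : IsSupport d) {S : Set R} {a : L} (hS : ∀ x ∈ S, d x ≤ a)
    {x : R} (hx : x ∈ (Ideal.span S).radical) : d x ≤ a := by
  obtain ⟨n, hn⟩ := hx
  exact (hd.le_map_pow x n).trans ((Ideal.span_le (I := hd.idealBelow a)).mpr hS hn)

end IsSupport

/-- The join of the values of `d` on a list. -/
def listSup {R L : Type*} [SemilatticeSup L] [OrderBot L] (d : R → L) (l : List R) : L :=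
  l.foldr (fun x a => d x ⊔ a) ⊥

theorem listSup_cons {R L : Type*} [SemilatticeSup L] [OrderBot L] (d : R → L) (x : R)
    (l : List R) : listSup d (x :: l) = d x ⊔ listSup d l := rfl

theorem listSup_le_iff {R L : Type*} [SemilatticeSup L] [OrderBot L] {d : R → L} {l : List R}
    {a : L} : listSup d l ≤ a ↔ ∀ x ∈ l, d x ≤ a := by
  induction l with
  | nil => simp [listSup]
  | cons x l ih => rw [listSup_cons, sup_le_iff, ih, List.forall_mem_cons]

/-- Distributivity of `L` enters here. Applied once in each argument, this reduces preservation of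
binary meets by `lift` to `d (x * y) = d x ⊓ d y`. -/
theorem listSup_inf_le_iff {R L : Type*} [DistribLattice L] [OrderBot L] {d : R → L}
    {l : List R} {a b : L} : listSup d l ⊓ b ≤ a ↔ ∀ x ∈ l, d x ⊓ b ≤ a := by
  induction l with
  | nil => simp [listSup]
  | cons x l ih => rw [listSup_cons, inf_sup_right, sup_le_iff, ih, List.forall_mem_cons]

theorem le_listSup {R L : Type*} [SemilatticeSup L] [OrderBot L] (d : R → L) {l : List R} {x : R}
    (h : x ∈ l) : d x ≤ listSup d l :=
  listSup_le_iff.mp le_rfl x h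

namespace ZariskiLattice

section Lift

variable {R : Type u} {L : Type*} [CommRing R] [DistribLattice L] [BoundedOrder L] {d : R → L}

/-- Gives both the well-definedness and the monotonicity of the extension of `d` to the Zariski
lattice. -/
theorem listSup_le_of_le (hd : IsSupport d) {l m : List R} (h : mk l ≤ mk m) :
    listSup d l ≤ listSup d m :=
  listSup_le_iff.mpr fun _ hx => hd.le_of_mem_radical_span (fun _ => le_listSup d)
    (D_le_iff.mp (mk_le_iff.mp h _ hx))

/-- The underlying function of `lift`. -/
def liftFun (hd : IsSupport d) : ZariskiLattice R → L :=
  Quotient.lift (s := zariskiSetoid R) (listSup d) fun _ _ h =>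
    le_antisymm (listSup_le_of_le hd (show _ ≤ _ from le_of_eq (α := Ideal R) h))
      (listSup_le_of_le hd (show _ ≤ _ from le_of_eq (α := Ideal R) h.symm))

theorem liftFun_mk (hd : IsSupport d) (l : List R) : liftFun hd (mk l) = listSup d l := rfl

theorem liftFun_mono (hd : IsSupport d) {a b : ZariskiLattice R} (h : a ≤ b) :
    liftFun hd a ≤ liftFun hd b := by
  induction a using ind with | h l =>
  induction b using ind with | h m =>
  exact listSup_le_of_le hd h

theorem liftFun_D (hd : IsSupport d) (f : R) : liftFun hd (D f) = d f := sup_bot_eq _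

/-- The Zariski lattice carries the universal support: a support `d` extends to a homomorphism
of bounded lattices sending `D(f)` to `d f`. -/
def lift (hd : IsSupport d) : BoundedLatticeHom (ZariskiLattice R) L where
  toFun := liftFun hd
  map_sup' a b := by
    refine le_antisymm ?_
      (sup_le (liftFun_mono hd le_sup_left) (liftFun_mono hd le_sup_right))
    induction a using ind with | h l =>
    induction b using ind with | h m =>
    rw [mk_sup_mk, liftFun_mk, liftFun_mk, liftFun_mk, listSup_le_iff]
    intro x hx
    rcases List.mem_append.mp hx with hx | hx
    · exact (le_listSup d hx).trans le_sup_left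
    · exact (le_listSup d hx).trans le_sup_right
  map_inf' a b := by
    refine le_antisymm
      (le_inf (liftFun_mono hd inf_le_left) (liftFun_mono hd inf_le_right)) ?_
    induction a using ind with | h l =>
    induction b using ind with | h m =>
    rw [mk_inf_mk, liftFun_mk, liftFun_mk, liftFun_mk, listSup_inf_le_iff]
    intro x hx
    rw [inf_comm, listSup_inf_le_iff]
    intro y hy
    rw [inf_comm, ← hd.map_mul]
    exact le_listSup d (List.mem_map.mpr ⟨(x, y), List.pair_mem_product.mpr ⟨hx, hy⟩, rfl⟩)
  map_top' := (liftFun_D hd 1).trans hd.map_one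
  map_bot' := rfl

theorem lift_D (hd : IsSupport d) (f : R) : lift hd (D f) = d f := liftFun_D hd f

theorem hom_ext {p q : BoundedLatticeHom (ZariskiLattice R) L} (h : ∀ f, p (D f) = q (D f)) :
    p = q := by
  refine DFunLike.ext _ _ fun v => ?_
  obtain ⟨n, f, rfl⟩ := exists_eq_sup v
  rw [map_finset_sup, map_finset_sup]
  exact congrArg _ (funext fun i => h (f i))

/-- Supplies the finite covers of `p v` by images of basic elements on which sections over `p v` are
glued and compared. -/
theorem hom_exists_sup (p : BoundedLatticeHom (ZariskiLattice R) L) (v : ZariskiLattice R) :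
    ∃ (n : ℕ) (f : Fin n → R), (∀ i, D (f i) ≤ v) ∧ p v = Finset.univ.sup fun i => p (D (f i)) := by
  obtain ⟨n, f, rfl⟩ := exists_eq_sup v
  refine ⟨n, f, fun i => Finset.le_sup (f := fun i => D (f i)) (Finset.mem_univ i), ?_⟩
  rw [map_finset_sup]
  rfl

end Lift

end ZariskiLattice

/-! ### Sections over joins and supports -/

/-- A section of a sheaf is determined by its restrictions to a finite cover. -/
theorem IsLatticeSheaf.ext {L : Type u} [Lattice L] [OrderBot L] {F : Lᵒᵖ ⥤ CommRingCat.{u}}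
    (hF : IsLatticeSheaf F) {n : ℕ} {x : L} {w : Fin n → L} (hx : x = Finset.univ.sup w)
    {s t : F.obj (op x)}
    (h : ∀ i (hi : w i ≤ x), restrict F hi s = restrict F hi t) : s = t := by
  have hle : ∀ i, w i ≤ x := fun i => hx ▸ Finset.le_sup (Finset.mem_univ i)
  -- The restrictions of `t` form a compatible family; `s` and `t` both glue it, so they agree by
  -- uniqueness of the gluing.
  refine (hF n x w hx (fun i => restrict F (hle i) t) fun i j => ?_).unique
    (fun i => h i _) fun i => rfl
  rw [restrict_restrict, restrict_restrict]

namespace LRDL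

variable (X : LRDL.{u})

theorem le_D_iff {w v : X.carrier} (hw : w ≤ v) (s : X.presheaf.obj (op v)) :
    w ≤ (X.D v s).1 ↔ IsUnit (restrict X.presheaf hw s) :=
  X.isInvertibilitySup v s w hw

/-- Below `w`, both sides dominate exactly the elements over which `s` becomes invertible. -/
theorem D_restrict {w v : X.carrier} (hw : w ≤ v) (s : X.presheaf.obj (op v)) :
    (X.D w (restrict X.presheaf hw s)).1 = (X.D v s).1 ⊓ w := by
  have key : ∀ a (ha : a ≤ w), a ≤ (X.D w (restrict X.presheaf hw s)).1 ↔ a ≤ (X.D v s).1 := by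
    intro a ha
    rw [X.le_D_iff ha, X.le_D_iff (ha.trans hw), restrict_restrict]
  refine le_antisymm (le_inf ((key _ (X.D w _).2).mp le_rfl) (X.D w _).2) ?_
  exact (key _ inf_le_right).mpr inf_le_left

/-! ### The morphism `Spec R → X` attached to `φ : R → Γ(X)` -/

variable {X} {R : Type u} [CommRing R] (φ : R →+* X.presheaf.obj (op ⊤))

theorem isSupport_global : IsSupport fun f => (X.D ⊤ (φ f)).1 where
  map_zero := by
    rw [map_zero, (X.isSupport ⊤).map_zero]
    rfl
  map_one := by
    rw [map_one, (X.isSupport ⊤).map_one]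
    rfl
  map_mul x y := by
    rw [map_mul, (X.isSupport ⊤).map_mul]
    rfl
  map_add_le x y := by
    rw [map_add]
    exact (X.isSupport ⊤).map_add_le _ _

/-- The lattice homomorphism `D(f) ↦ D_⊤(φ f)`. -/
def baseOf : BoundedLatticeHom (ZariskiLattice R) X.carrier :=
  ZariskiLattice.lift (isSupport_global φ)

theorem baseOf_D (f : R) : baseOf φ (ZariskiLattice.D f) = (X.D ⊤ (φ f)).1 :=
  ZariskiLattice.lift_D (isSupport_global φ) f

/-- The composite of `φ` with the restriction of global sections to `v`. -/
def globalTo (v : X.carrier) : R →+* X.presheaf.obj (op v) :=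
  (restrict X.presheaf le_top).comp φ

theorem globalTo_apply (v : X.carrier) (r : R) :
    globalTo φ v r = restrict X.presheaf le_top (φ r) := rfl

theorem restrict_globalTo {w v : X.carrier} (h : w ≤ v) (r : R) :
    restrict X.presheaf h (globalTo φ v r) = globalTo φ w r :=
  restrict_restrict _ _ _ _

theorem isUnit_globalTo_iff {v : X.carrier} {f : R} :
    IsUnit (globalTo φ v f) ↔ v ≤ baseOf φ (ZariskiLattice.D f) := by
  rw [baseOf_D, X.le_D_iff le_top, globalTo_apply]

/-- The map `R[1/f] → F(v)` induced by `φ`, for `v` below `D_⊤(φ f)`. -/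
noncomputable def awayTo {v : X.carrier} (f : R) (h : v ≤ baseOf φ (ZariskiLattice.D f)) :
    Localization.Away f →+* X.presheaf.obj (op v) :=
  IsLocalization.Away.lift f (g := globalTo φ v) ((isUnit_globalTo_iff φ).mpr h)

theorem awayTo_algebraMap {v : X.carrier} {f : R} (h : v ≤ baseOf φ (ZariskiLattice.D f))
    (r : R) : awayTo φ f h (algebraMap R _ r) = globalTo φ v r :=
  IsLocalization.Away.lift_eq f (g := globalTo φ v) ((isUnit_globalTo_iff φ).mpr h) r

theorem restrict_awayTo {w v : X.carrier} {f : R} (h : v ≤ baseOf φ (ZariskiLattice.D f))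
    (hw : w ≤ v) (x : Localization.Away f) :
    restrict X.presheaf hw (awayTo φ f h x) = awayTo φ f (hw.trans h) x := by
  have : (restrict X.presheaf hw).comp (awayTo φ f h) = awayTo φ f (hw.trans h) := by
    refine ZariskiLattice.away_ringHom_ext fun r => ?_
    rw [RingHom.comp_apply, awayTo_algebraMap, awayTo_algebraMap, restrict_globalTo]
  exact congrArg (fun p => p x) this

/-- Both sides are ring homomorphisms out of `R[1/f]` with the same restriction to `R`. This lets
fractions with different denominators be compared over a common one. -/
theorem awayTo_res {v : X.carrier} {f g : R} (hg : v ≤ baseOf φ (ZariskiLattice.D g))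
    (h : ZariskiLattice.D g ≤ ZariskiLattice.D f) (x : Localization.Away f) :
    awayTo φ g hg (ZariskiLattice.res h x) =
      awayTo φ f (hg.trans (OrderHomClass.mono (baseOf φ) h)) x := by
  have : (awayTo φ g hg).comp (ZariskiLattice.res h).toRingHom =
      awayTo φ f (hg.trans (OrderHomClass.mono (baseOf φ) h)) := by
    refine ZariskiLattice.away_ringHom_ext fun r => ?_
    change awayTo φ g hg (ZariskiLattice.res h (algebraMap R _ r)) = _
    rw [AlgHom.commutes, awayTo_algebraMap, awayTo_algebraMap]
  exact congrArg (fun p => p x) this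

theorem baseOf_section_ext {v : ZariskiLattice R} {s t : X.presheaf.obj (op (baseOf φ v))}
    (h : ∀ f (hf : ZariskiLattice.D f ≤ v),
      restrict X.presheaf (OrderHomClass.mono (baseOf φ) hf) s =
        restrict X.presheaf (OrderHomClass.mono (baseOf φ) hf) t) : s = t := by
  obtain ⟨n, f, hf, hv⟩ := ZariskiLattice.hom_exists_sup (baseOf φ) v
  exact X.isSheaf.ext hv fun i _ => h (f i) (hf i)

theorem exists_sharpOf (v : ZariskiLattice R)
    (s : (ZariskiLattice.structureSheaf R).obj (op v)) :
    ∃ t : X.presheaf.obj (op (baseOf φ v)), ∀ f (hf : ZariskiLattice.D f ≤ v),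
      restrict X.presheaf (OrderHomClass.mono (baseOf φ) hf) t =
        awayTo φ f le_rfl (ZariskiLattice.eval f hf s) := by
  obtain ⟨n, f, hf, hv⟩ := ZariskiLattice.hom_exists_sup (baseOf φ) v
  -- The value over `w` does not depend on the basic element used to compute it: `w` lies below the
  -- image of `D(a * b)`, so both maps factor through `R[1/(a * b)]`, where the two values of `s`
  -- coincide.
  have key : ∀ a b w (ha : ZariskiLattice.D a ≤ v) (hb : ZariskiLattice.D b ≤ v)
      (hwa : w ≤ baseOf φ (ZariskiLattice.D a)) (hwb : w ≤ baseOf φ (ZariskiLattice.D b)),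
      awayTo φ a hwa (ZariskiLattice.eval a ha s) =
        awayTo φ b hwb (ZariskiLattice.eval b hb s) := by
    intro a b w ha hb hwa hwb
    have hw : w ≤ baseOf φ (ZariskiLattice.D (a * b)) := by
      rw [ZariskiLattice.D_mul, map_inf]
      exact le_inf hwa hwb
    rw [← awayTo_res φ hw (ZariskiLattice.D_mul_le_left a b),
      ← awayTo_res φ hw (ZariskiLattice.D_mul_le_right a b), ZariskiLattice.res_eval,
      ZariskiLattice.res_eval]
  obtain ⟨t, ht, -⟩ := X.isSheaf n (baseOf φ v) (fun i => baseOf φ (ZariskiLattice.D (f i))) hv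
    (fun i => awayTo φ (f i) le_rfl (ZariskiLattice.eval (f i) (hf i) s)) (by
      intro i j
      rw [restrict_awayTo, restrict_awayTo]
      exact key _ _ _ _ _ _ _)
  refine ⟨t, fun g hg => ?_⟩
  have hgv := OrderHomClass.mono (baseOf φ) hg
  -- By construction `t` is known only over the images of the chosen `D(f i)`. For arbitrary `g`,
  -- the comparison is made on the cover of the image of `D(g)` by its meets with these.
  have hcov : baseOf φ (ZariskiLattice.D g) = Finset.univ.sup fun i =>
      baseOf φ (ZariskiLattice.D g) ⊓ baseOf φ (ZariskiLattice.D (f i)) := by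
    rw [← Finset.sup_inf_distrib_left]
    exact (inf_eq_left.mpr (hgv.trans hv.le)).symm
  refine X.isSheaf.ext hcov fun i hi => ?_
  rw [restrict_restrict, restrict_awayTo,
    ← restrict_restrict (b := baseOf φ (ZariskiLattice.D (f i))) X.presheaf inf_le_right
      (OrderHomClass.mono (baseOf φ) (hf i)), ht i, restrict_awayTo]
  exact key _ _ _ _ _ _ _

/-- The component at `v` of the sheaf part of the morphism `Spec R → X` belonging to `φ`. It is
the unique extension of the maps `R[1/f] → F(D_⊤(φ f))`. -/
noncomputable def sharpOf (v : ZariskiLattice R) :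
    (ZariskiLattice.structureSheaf R).obj (op v) →+* X.presheaf.obj (op (baseOf φ v)) where
  toFun s := (exists_sharpOf φ v s).choose
  map_one' := baseOf_section_ext φ fun f hf => by
    rw [(exists_sharpOf φ v 1).choose_spec f hf, map_one, map_one, map_one]
  map_mul' s t := baseOf_section_ext φ fun f hf => by
    rw [(exists_sharpOf φ v (s * t)).choose_spec f hf, map_mul, map_mul, map_mul,
      (exists_sharpOf φ v s).choose_spec f hf, (exists_sharpOf φ v t).choose_spec f hf]
  map_zero' := baseOf_section_ext φ fun f hf => by
    rw [(exists_sharpOf φ v 0).choose_spec f hf, map_zero, map_zero, map_zero]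
  map_add' s t := baseOf_section_ext φ fun f hf => by
    rw [(exists_sharpOf φ v (s + t)).choose_spec f hf, map_add, map_add, map_add,
      (exists_sharpOf φ v s).choose_spec f hf, (exists_sharpOf φ v t).choose_spec f hf]

theorem restrict_sharpOf {v : ZariskiLattice R}
    (s : (ZariskiLattice.structureSheaf R).obj (op v)) {f : R} (hf : ZariskiLattice.D f ≤ v) :
    restrict X.presheaf (OrderHomClass.mono (baseOf φ) hf) (sharpOf φ v s) =
      awayTo φ f le_rfl (ZariskiLattice.eval f hf s) :=
  (exists_sharpOf φ v s).choose_spec f hf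

theorem sharpOf_restrict {w v : ZariskiLattice R} (h : w ≤ v)
    (s : (ZariskiLattice.structureSheaf R).obj (op v)) :
    sharpOf φ w (restrict (ZariskiLattice.structureSheaf R) h s) =
      restrict X.presheaf (OrderHomClass.mono (baseOf φ) h) (sharpOf φ v s) := by
  refine baseOf_section_ext φ fun f hf => ?_
  rw [restrict_sharpOf φ _ hf, ZariskiLattice.eval_restrict, restrict_restrict,
    restrict_sharpOf φ s (hf.trans h)]

/-- One inequality holds because ring homomorphisms preserve units. The other is local: over `D(f
i)` the section is a fraction `a / f i ^ k`, and its image can only be invertible where `a` becomes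
invertible. -/
theorem baseOf_support (v : ZariskiLattice R)
    (s : (ZariskiLattice.structureSheaf R).obj (op v)) :
    baseOf φ (ZariskiLattice.support v s).1 = (X.D (baseOf φ v) (sharpOf φ v s)).1 := by
  refine le_antisymm ?_ ?_
  · rw [X.le_D_iff (OrderHomClass.mono (baseOf φ) (ZariskiLattice.support v s).2),
      ← sharpOf_restrict]
    exact ((ZariskiLattice.support_isInvertibilitySup v s _
      (ZariskiLattice.support v s).2).mp le_rfl).map _
  · obtain ⟨n, f, hf, hv⟩ := ZariskiLattice.hom_exists_sup (baseOf φ) v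
    rw [← inf_eq_left.mpr ((X.D (baseOf φ v) (sharpOf φ v s)).2.trans hv.le),
      Finset.sup_inf_distrib_left]
    refine Finset.sup_le fun i _ => ?_
    obtain ⟨k, a, ha⟩ := ZariskiLattice.exists_fraction (ZariskiLattice.eval (f i) (hf i) s)
    -- In `R[1/(f i * a)]` the unit `a` equals `f i ^ k` times the value of `s`, so that value is a
    -- unit too.
    have h₁ : ZariskiLattice.D (f i * a) ≤ (ZariskiLattice.support v s).1 := by
      refine (ZariskiLattice.D_le_support_iff
        ((ZariskiLattice.D_mul_le_left _ _).trans (hf i))).mpr ?_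
      rw [← ZariskiLattice.res_eval (hf i) (ZariskiLattice.D_mul_le_left _ _)]
      have h₂ : IsUnit (algebraMap R (Localization.Away (f i * a)) a) :=
        ZariskiLattice.isUnit_algebraMap_iff.mpr (ZariskiLattice.D_mul_le_right _ _)
      rw [← (ZariskiLattice.res (ZariskiLattice.D_mul_le_left (f i) a)).commutes, ← ha,
        Algebra.smul_def, map_mul, IsUnit.mul_iff] at h₂
      exact h₂.2
    refine le_trans ?_ (OrderHomClass.mono (baseOf φ) h₁)
    rw [ZariskiLattice.D_mul, map_inf]
    refine le_inf inf_le_right ((isUnit_globalTo_iff φ).mp ?_)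
    have h₃ := (X.le_D_iff (inf_le_left.trans (X.D (baseOf φ v) (sharpOf φ v s)).2) _).mp
      (inf_le_left : (X.D (baseOf φ v) (sharpOf φ v s)).1 ⊓
        baseOf φ (ZariskiLattice.D (f i)) ≤ (X.D (baseOf φ v) (sharpOf φ v s)).1)
    rw [← restrict_restrict X.presheaf inf_le_right (OrderHomClass.mono (baseOf φ) (hf i)),
      restrict_sharpOf φ s (hf i), restrict_awayTo φ le_rfl inf_le_right] at h₃
    -- Over the meet, the image of `a` is the image of `f i ^ k` times that of `s`. The first factor
    -- is a unit already in `R[1/f i]`, the second by `h₃`.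
    rw [← awayTo_algebraMap φ (f := f i) inf_le_right, ← ha, Algebra.smul_def, map_mul]
    exact ((ZariskiLattice.isUnit_pow (f i) k).map _).mul h₃

/-- The morphism `Spec R → X` belonging to a ring homomorphism `φ : R → Γ(X)`. -/
noncomputable def homOf : (specObj R).Hom X where
  base := baseOf φ
  sharp :=
    { app := fun v => CommRingCat.ofHom (sharpOf φ v.unop)
      naturality := fun _ _ h => CommRingCat.hom_ext
        (RingHom.ext fun s => sharpOf_restrict φ h.unop.le s) }
  map_D := baseOf_support φ

end LRDL

/-! ### The adjunction -/

namespace ZariskiLattice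

variable {R : Type u} [CommRing R]

/-- The section of the structure sheaf over `v` given by an element of the ring. -/
def ofRing (v : ZariskiLattice R) : R →+* (structureSheaf R).obj (op v) :=
  algebraMap R (sections R v)

/-- A basic element `D(g)` lies below either side exactly when `r` is invertible in `R[1/g]`. Every
`D(r)` is thus the support of a global section, so a morphism of locally ringed lattices has no
freedom on it. -/
theorem support_ofRing (r : R) : (support ⊤ (ofRing ⊤ r)).1 = D r := by
  refine le_antisymm (le_of_D_le fun g hg => ?_) (le_of_D_le fun g hg => ?_)
  · exact isUnit_algebraMap_iff.mp ((D_le_support_iff le_top).mp hg)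
  · exact (D_le_support_iff le_top).mpr (isUnit_algebraMap_iff.mpr hg)

/-- The canonical isomorphism `R ≅ O_R(⊤)`. -/
theorem ofRing_top_bijective : Function.Bijective (ofRing (⊤ : ZariskiLattice R)) := by
  have h : Function.Bijective (algebraMap R (Localization.Away (1 : R))) :=
    (IsLocalization.atUnit R (Localization.Away (1 : R)) 1 isUnit_one).bijective
  -- Since `⊤` is `D 1` by definition, `sectionsEquiv 1` applies to global sections, and its
  -- composite with `ofRing ⊤` is `R → R[1/1]`.
  exact (Function.Bijective.of_comp_iff' (sectionsEquiv (1 : R)).bijective (ofRing ⊤)).mp h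

/-- Transports the universal property of `R[1/f]` along `O_R(D(f)) ≅ R[1/f]`. -/
theorem ofRing_D_hom_ext {f : R} {B : Type*} [CommRing B]
    {p q : (structureSheaf R).obj (op (D f)) →+* B}
    (h : ∀ r, p (ofRing _ r) = q (ofRing _ r)) : p = q := by
  have hr : ∀ r, (sectionsEquiv f).symm (algebraMap R _ r) = ofRing (D f) r := fun r =>
    (sectionsEquiv f).injective ((sectionsEquiv f).apply_symm_apply _)
  have : p.comp (sectionsEquiv f).symm.toRingHom = q.comp (sectionsEquiv f).symm.toRingHom :=
    away_ringHom_ext fun r =>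
      ((congrArg p (hr r)).trans (h r)).trans (congrArg q (hr r)).symm
  refine RingHom.ext fun s => ?_
  have := congrArg (fun k => k (sectionsEquiv f s)) this
  simpa using this

end ZariskiLattice

namespace LRDL

/-! ### Morphisms `Spec R → X` and ring homomorphisms `R → Γ(X)` -/

/-- The ring homomorphism `R → Γ(X)` belonging to a morphism `Spec R → X`. -/
noncomputable def ringHomOf {R : Type u} [CommRing R] {X : LRDL.{u}} (p : (specObj R).Hom X) :
    R →+* X.presheaf.obj (op ⊤) :=
  p.globalMap.comp (ZariskiLattice.ofRing ⊤)

section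

variable {R : Type u} [CommRing R] {X : LRDL.{u}}

theorem app_ofRing (p : (specObj R).Hom X) (v : ZariskiLattice R) (r : R) :
    p.toHom.app v (ZariskiLattice.ofRing v r) = globalTo (ringHomOf p) (p.base v) r := by
  refine Eq.trans ?_ (restrict_restrict X.presheaf _ _ _).symm
  exact p.toHom.app_restrict (le_top : v ≤ (⊤ : ZariskiLattice R)) (ZariskiLattice.ofRing ⊤ r)

/-- Compatibility with the invertibility supports, applied to the global section `f` with support
`D(f)`, leaves only one possible value at `D(f)`; the basic elements generate the lattice. -/
theorem base_eq (p : (specObj R).Hom X) : p.base = baseOf (ringHomOf p) := by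
  refine ZariskiLattice.hom_ext fun f => ?_
  have h₁ := p.map_D (⊤ : ZariskiLattice R) (ZariskiLattice.ofRing ⊤ f)
  rw [baseOf_D]
  refine (congrArg p.base (ZariskiLattice.support_ofRing f)).symm.trans (h₁.trans ?_)
  -- The section lives over `p.base ⊤`, which is only propositionally `⊤`; restricting it to `⊤`
  -- leaves its support unchanged.
  refine Eq.trans ?_ (((X.D_restrict (map_top p.base).ge _).trans
    (inf_eq_left.mpr le_top)).symm)
  rfl

theorem ringHomOf_injective : Function.Injective (ringHomOf (R := R) (X := X)) := by
  intro p q h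
  have hb : p.base = q.base := by rw [base_eq, base_eq, h]
  refine LRDL.Hom.ext' (RDL.Hom.ext' (fun v => DFunLike.congr_fun hb v) fun v s => ?_)
  obtain ⟨n, f, hf, hv⟩ := ZariskiLattice.hom_exists_sup q.base v
  refine X.isSheaf.ext hv fun i hi => ?_
  have hi' : ZariskiLattice.D (f i) ≤ v := hf i
  -- On a basic element the two sheaf parts agree on the image of `R`, hence everywhere. The
  -- restriction serves as transport along the equality of the two lattice maps.
  have key : (restrict X.presheaf (DFunLike.congr_fun hb (ZariskiLattice.D (f i))).ge).comp
      (p.toHom.app (ZariskiLattice.D (f i))) = q.toHom.app (ZariskiLattice.D (f i)) := by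
    refine ZariskiLattice.ofRing_D_hom_ext fun r => ?_
    refine (congrArg _ (app_ofRing p _ r)).trans (Eq.trans ?_ (app_ofRing q _ r).symm)
    exact (restrict_globalTo (ringHomOf p) _ r).trans
      (congrArg (fun φ : R →+* X.presheaf.obj (op ⊤) => globalTo φ _ r) h)
  have hp := p.toHom.app_restrict hi' s
  have hq := q.toHom.app_restrict hi' s
  refine Eq.trans ?_ hq
  refine Eq.trans ?_ (RingHom.congr_fun key _)
  refine Eq.trans ?_ (congrArg _ hp).symm
  exact (restrict_restrict X.presheaf _ _ _).trans (restrict_restrict X.presheaf _ _ _).symm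

theorem ringHomOf_homOf (φ : R →+* X.presheaf.obj (op ⊤)) : ringHomOf (homOf φ) = φ := by
  refine RingHom.ext fun r => ?_
  have h₁ : baseOf φ (ZariskiLattice.D 1) = ⊤ := map_top (baseOf φ)
  -- A trivial restriction is inserted so that the characterization of `sharpOf` on basic elements
  -- applies at `f = 1`, where `D 1` is `⊤`.
  refine (congrArg _ (restrict_self X.presheaf le_rfl _).symm).trans ?_
  refine (congrArg _ (restrict_sharpOf φ (ZariskiLattice.ofRing ⊤ r)
    (le_refl (ZariskiLattice.D 1)))).trans ?_
  refine (congrArg _ (awayTo_algebraMap φ le_rfl r)).trans ?_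
  exact (restrict_globalTo φ _ r).trans (restrict_self _ _ _)

theorem ringHomOf_bijective : Function.Bijective (ringHomOf (R := R) (X := X)) :=
  ⟨ringHomOf_injective, fun φ => ⟨homOf φ, ringHomOf_homOf φ⟩⟩

/-- Naturality in `R` of the map `R → Γ(Spec R)`. Sections over the image of `⊤` are compared on the
elements `D(φ f)`, where both give the fraction `φ r / 1`. -/
theorem ringHomOf_specMap {A : Type u} [CommRing A] (φ : R →+* A) :
    ringHomOf (specMap φ) = (ZariskiLattice.ofRing ⊤).comp φ := by
  refine RingHom.ext fun r => ?_
  have h : ZariskiLattice.sharp φ ⊤ (ZariskiLattice.ofRing ⊤ r) =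
      ZariskiLattice.ofRing _ (φ r) :=
    ZariskiLattice.map_section_ext φ fun f hf =>
      (ZariskiLattice.eval_sharp φ _ hf).trans (ZariskiLattice.awayMap_algebraMap φ f r)
  exact congrArg (restrict (ZariskiLattice.structureSheaf A) (map_top (ZariskiLattice.map φ)).ge) h

end

/-- The bijection between morphisms `Spec R → X` and ring homomorphisms `R → Γ(X)`. -/
noncomputable def specHomEquiv (R : CommRingCat.{u}) (X : LRDL.{u}) :
    (spec.obj R ⟶ X) ≃ (R ⟶ globalSections.obj X) :=
  (Equiv.ofBijective _ (ringHomOf_bijective (R := R) (X := X))).trans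
    ⟨CommRingCat.ofHom, CommRingCat.Hom.hom, fun _ => rfl, fun _ => rfl⟩

/-- The canonical map `R → Γ(Spec R)`. -/
noncomputable def toGlobal (R : CommRingCat.{u}) : R ⟶ globalSections.obj (spec.obj R) :=
  CommRingCat.ofHom (ZariskiLattice.ofRing (⊤ : ZariskiLattice R))

/-- In this form, naturality of the bijection in `X` is functoriality of global sections, and
naturality in `R` is that of `toGlobal`. -/
theorem specHomEquiv_apply {R : CommRingCat.{u}} {X : LRDL.{u}} (p : spec.obj R ⟶ X) :
    specHomEquiv R X p = toGlobal R ≫ globalSections.map p := rfl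

theorem toGlobal_naturality {R A : CommRingCat.{u}} (φ : R ⟶ A) :
    φ ≫ toGlobal A = toGlobal R ≫ globalSections.map (spec.map φ) :=
  (CommRingCat.hom_ext (ringHomOf_specMap φ.hom)).symm

/-- The covariant functor `spec` is left adjoint to global sections. -/
noncomputable def specAdjunction : spec.{u} ⊣ globalSections.{u} :=
  Adjunction.mkOfHomEquiv
    { homEquiv := specHomEquiv
      homEquiv_naturality_left_symm := fun {R A X} φ g => by
        rw [Equiv.symm_apply_eq]
        obtain ⟨p, rfl⟩ := (specHomEquiv A X).surjective g
        rw [Equiv.symm_apply_apply, specHomEquiv_apply, specHomEquiv_apply, Functor.map_comp,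
          ← Category.assoc, ← Category.assoc, toGlobal_naturality]
      homEquiv_naturality_right := fun p q => by
        rw [specHomEquiv_apply, specHomEquiv_apply, Functor.map_comp, Category.assoc] }

theorem specAdjunction_unit_app (R : CommRingCat.{u}) :
    specAdjunction.unit.app R = toGlobal R := by
  rw [← specAdjunction.homEquiv_id]
  change specHomEquiv R _ (𝟙 _) = _
  rw [specHomEquiv_apply, CategoryTheory.Functor.map_id, Category.comp_id]

instance isIso_specAdjunction_unit : IsIso specAdjunction.{u}.unit := by
  have (R : CommRingCat.{u}) : IsIso (specAdjunction.unit.app R) := by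
    rw [specAdjunction_unit_app]
    exact (RingEquiv.ofBijective _ ZariskiLattice.ofRing_top_bijective).toCommRingCatIso.isIso_hom
  exact NatIso.isIso_of_isIso_app _

end LRDL

theorem mainTheorem2 :
    ∃ adj : LRDL.Gamma.{u} ⊣ LRDL.Spec.{u}, IsIso adj.counit := by
  let adj : LRDL.Gamma.{u} ⊣ LRDL.Spec.{u} := LRDL.specAdjunction.op
  have (R : CommRingCat.{u}ᵒᵖ) : IsIso (adj.counit.app R) :=
    -- The counit of the opposite adjunction is, componentwise and by definition, the opposite of
    -- the unit.
    inferInstanceAs (IsIso (LRDL.specAdjunction.unit.app R.unop).op)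
  exact ⟨adj, NatIso.isIso_of_isIso_app _⟩
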